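/- Let $\Gamma=\mathbb Q^2\rtimes G$ with $G=SL_2(\mathbb Q)$ acting on $\mathbb Q^2$ by matrix multiplication, let $L(\Gamma)$ be the group von Neumann algebra generated by the canonical unitaries $u_\gamma$ ($\gamma\in\Gamma$) of the left regular representation on $\ell^2(\Gamma)$, and let $L(\mathbb Q^2),L(G)\subseteq L(\Gamma)$ be the von Neumann subalgebras generated by $\{u_v\}_{v\in\mathbb Q^2}$ and $\{u_g\}_{g\in G}$. Let $A\subseteq L(\mathbb Q^2)$ be the von Neumann subalgebra of all elements with Fourier expansion $\sum_{v\in\mathbb Q^2}c_vu_v$ such that $c_v=c_{-v}$ for all $v\in\mathbb Q^2$, and let $A\rtimes G\subseteq L(\mathbb Q^2)\rtimes G=L(\Gamma)$ be the crossed product by the conjugation action of $G$, that is, the von Neumann subalgebra of $L(\Gamma)$ generated by $A$ and $\{u_g\}_{g\in G}$. Put $q=\frac{u_{id}+u_{-id}}{2}$, where $id\in G$ is the identity matrix. Then $q$ is a central projection in $A\rtimes G$, and every von Neumann algebra $P$ with $L(G)\subseteq P\subseteq A\rtimes G$ satisfies $$P\in\Big\{L(G),\ A\rtimes G,\ qL(G)\oplus(1-q)(A\rtimes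 G),\ (1-q)L(G)\oplus q(A\rtimes G)\Big\}.$$ -/

import Mathlib

/-- The Hilbert space `ℓ²(Γ)` of a discrete group `Γ`. -/
abbrev EllTwo (Γ : Type*) : Type _ := lp (fun _ : Γ => ℂ) 2

/-- The canonical unitary `u_γ` of the left regular representation of `Γ`:
`(u_γ ξ)(h) = ξ(γ⁻¹ h)`, so that `u_γ δ_h = δ_{γ h}`. -/
noncomputable def leftRegularOp {Γ : Type*} [Group Γ] (γ : Γ) :
    EllTwo Γ →L[ℂ] EllTwo Γ :=
  LinearIsometry.toContinuousLinearMap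
    { toFun := fun ξ => ⟨fun h => ξ (γ⁻¹ * h), by
        have hξ := (memℓp_gen_iff (by norm_num)).1 (lp.memℓp ξ)
        exact memℓp_gen ((Equiv.mulLeft γ⁻¹).summable_iff.2 hξ)⟩
      map_add' := fun _ _ => rfl
      map_smul' := fun _ _ => rfl
      norm_map' := fun ξ => by
        rw [lp.norm_eq_tsum_rpow (by norm_num), lp.norm_eq_tsum_rpow (by norm_num)]
        congr 1
        exact (Equiv.mulLeft γ⁻¹).tsum_eq (fun h => ‖ξ h‖ ^ (2 : ENNReal).toReal) }

/-- The von Neumann algebra generated by a set `S` of bounded operators on a Hilbert space: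
the double commutant of `S ∪ S*`. -/
noncomputable def generatedVN {H : Type*} [NormedAddCommGroup H] [InnerProductSpace ℂ H]
    [CompleteSpace H] (S : Set (H →L[ℂ] H)) : VonNeumannAlgebra H where
  toStarSubalgebra :=
    StarSubalgebra.centralizer ℂ (StarSubalgebra.centralizer ℂ S : Set (H →L[ℂ] H))
  centralizer_centralizer' := by
    change Set.centralizer (Set.centralizer (StarSubalgebra.centralizer ℂ
      (StarSubalgebra.centralizer ℂ S : Set (H →L[ℂ] H)) : Set (H →L[ℂ] H))) =
      (StarSubalgebra.centralizer ℂ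
        (StarSubalgebra.centralizer ℂ S : Set (H →L[ℂ] H)) : Set (H →L[ℂ] H))
    rw [StarSubalgebra.coe_centralizer_centralizer, Set.centralizer_centralizer_centralizer]

/-- The Fourier coefficient `c_γ` of an operator `x` on `ℓ²(Γ)`, i.e. `⟨x δ_e, δ_γ⟩`. An element `x`
of `L(Γ)` has the Fourier expansion `x = ∑ c_γ u_γ`. -/
noncomputable def groupFourierCoeff {Γ : Type*} [Group Γ] (x : EllTwo Γ →L[ℂ] EllTwo Γ)
    (γ : Γ) : ℂ :=
  letI := Classical.decEq Γ
  (x (lp.single 2 (1 : Γ) (1 : ℂ)) : Γ → ℂ) γ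

/-- The group `SL₂(ℚ)`. -/
abbrev SL2Q : Type := Matrix.SpecialLinearGroup (Fin 2) ℚ

/-- The action of `SL₂(ℚ)` on `ℚ²` by matrix multiplication from the left. -/
def sl2QAction : SL2Q →* MulAut (Multiplicative (Fin 2 → ℚ)) where
  toFun g := AddEquiv.toMultiplicative (Matrix.SpecialLinearGroup.toLin' g).toAddEquiv
  map_one' := by
    ext v : 1
    exact congrArg Multiplicative.ofAdd
      (LinearEquiv.congr_fun (map_one Matrix.SpecialLinearGroup.toLin') v.toAdd)
  map_mul' g h := by
    ext v : 1
    exact congrArg Multiplicative.ofAdd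
      (LinearEquiv.congr_fun (map_mul Matrix.SpecialLinearGroup.toLin' g h) v.toAdd)

/-- The group `ℚ² ⋊ SL₂(ℚ)`. -/
abbrev AffineSL2Q : Type := Multiplicative (Fin 2 → ℚ) ⋊[sl2QAction] SL2Q

/-- The element of `ℚ² ⋊ SL₂(ℚ)` given by `v ∈ ℚ²`. -/
def translation (v : Fin 2 → ℚ) : AffineSL2Q := SemidirectProduct.inl (Multiplicative.ofAdd v)

/-- The canonical unitary `u_v`, `v ∈ ℚ²`, in `L(ℚ² ⋊ SL₂(ℚ))`. -/
noncomputable def uVec (v : Fin 2 → ℚ) : EllTwo AffineSL2Q →L[ℂ] EllTwo AffineSL2Q :=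
  leftRegularOp (translation v)

/-- The canonical unitary `u_g`, `g ∈ SL₂(ℚ)`, in `L(ℚ² ⋊ SL₂(ℚ))`. -/
noncomputable def uMat (g : SL2Q) : EllTwo AffineSL2Q →L[ℂ] EllTwo AffineSL2Q :=
  leftRegularOp (SemidirectProduct.inr g)

/-- `L(ℚ²)`, as a von Neumann subalgebra of `L(ℚ² ⋊ SL₂(ℚ))`. -/
noncomputable def LQ2 : VonNeumannAlgebra (EllTwo AffineSL2Q) :=
  generatedVN (Set.range uVec)

/-- `L(G)` for `G = SL₂(ℚ)`, as a von Neumann subalgebra of `L(ℚ² ⋊ SL₂(ℚ))`. -/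
noncomputable def LSL2Q : VonNeumannAlgebra (EllTwo AffineSL2Q) :=
  generatedVN (Set.range uMat)

/-- The set `A` of all `∑ c_v u_v` in `L(ℚ²)` such that `c_v = c_{-v}` for all `v ∈ ℚ²`. -/
def symmetricPart : Set (EllTwo AffineSL2Q →L[ℂ] EllTwo AffineSL2Q) :=
  {a | a ∈ LQ2 ∧
    ∀ v : Fin 2 → ℚ, groupFourierCoeff a (translation v) = groupFourierCoeff a (translation (-v))}

/-- The crossed product `A ⋊ G` of `A` by the conjugation action `a ↦ u_g a u_g*` of `G = SL₂(ℚ)`,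
as a von Neumann subalgebra of `L(ℚ²) ⋊ G = L(ℚ² ⋊ G)`: it is generated by `A` and the
unitaries `u_g`. On `ℓ²(ℚ² ⋊ G) = ℓ²(ℚ²) ⊗ ℓ²(G)` an element `a ∈ L(ℚ²)` acts as `a ⊗ 1` and `u_g`
acts as `U_g ⊗ λ_g`, where `U_g δ_v = δ_{g v}` and `λ` is the left regular representation, so this
is the usual crossed product for the action `Ad U_g` of `G` on `A`. -/
noncomputable def crossedProduct : VonNeumannAlgebra (EllTwo AffineSL2Q) :=
  generatedVN (symmetricPart ∪ Set.range uMat)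

/-- The element `q = (u_id + u_{-id}) / 2`. -/
noncomputable def qProj : EllTwo AffineSL2Q →L[ℂ] EllTwo AffineSL2Q :=
  (1 / 2 : ℂ) • (uMat 1 + uMat (-1))

/-- The set `p M ⊕ (1 - p) N` of all operators `p x + (1 - p) y` with `x ∈ M` and `y ∈ N`. -/
def cornerSum {H : Type*} [NormedAddCommGroup H] [InnerProductSpace ℂ H] [CompleteSpace H]
    (p : H →L[ℂ] H) (M N : VonNeumannAlgebra H) : Set (H →L[ℂ] H) :=
  {z | ∃ x ∈ M, ∃ y ∈ N, z = p * x + (1 - p) * y}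

/-!
Let `e` be the orthogonal projection of `ℓ²(Γ)` onto the closure of `P δ_1`. Since `P` contains
`L(G)`, `e` commutes with `u_g` and `ρ_g` for `g ∈ G`, so `e δ_{e₁}` is invariant under conjugation
by the stabilizer of `e₁`. Square summability confines it to the elements with finite orbit, which
lie in `{(t e₁, ±[[1, s], [0, 1]])}`; the conjugates of `e δ_{e₁}` by `G` are confined accordingly.

Write `z = -id`, and let `q` be the spectral projection of `u_z` for the eigenvalue `σ = ±1`. The
coefficient of `e(u_{e₂} q e δ_{e₁})` at a group element can be computed in two ways: by expanding
`q e δ_{e₁}`, and by expanding `e δ_{e₂}` after using that `e` is a `P`-bimodule map. Comparing the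
two shows first that `f(t, s) = (q e δ_{e₁})(t e₁, [[1, s], [0, 1]])` vanishes for `s ≠ 0`, and then
that `f(b, 0) f(a, 0) = f(a / b, 0) f(b, 0)`. So `f(t, 0) ≠ 0` forces `f(tⁿ, 0) = f(t, 0)` for all
`n ≥ 1`, which by square summability is possible only for `t = ±1` (`t = 0` is excluded because `e`
fixes `δ_1`, which is orthogonal to `δ_{e₁}`). Together with `u_z` commuting with `P` this makes
`q e δ_{e₁}` either `0` or the image under `q` of `(δ_{e₁} + δ_{-e₁}) / 2`.

Since `G` acts transitively on `ℚ² \ {0}`, that single alternative determines `q P`: it is `q L(G)`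
in the first case and `q (A ⋊ G)` in the second. The two signs give the four algebras.
-/

open scoped InnerProductSpace

theorem hasSum_pair {ι M : Type*} [AddCommMonoid M] [TopologicalSpace M] {f : ι → M} {a b : ι}
    (hab : a ≠ b) (hf : ∀ i, f i ≠ 0 → i = a ∨ i = b) : HasSum f (f a + f b) := by
  classical
  rw [← Finset.sum_pair hab]
  refine hasSum_sum_of_ne_finset_zero fun i hi => ?_
  by_contra hne
  exact hi (by simpa using hf i hne)

section VonNeumannAlgebra

variable {H : Type*} [NormedAddCommGroup H] [InnerProductSpace ℂ H] [CompleteSpace H]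

theorem subset_generatedVN (S : Set (H →L[ℂ] H)) : S ⊆ generatedVN S := by
  intro x hx
  refine (StarSubalgebra.mem_centralizer_iff ℂ).2 fun T hT => ?_
  exact ⟨((StarSubalgebra.mem_centralizer_iff ℂ).1 hT x hx).1.symm,
    ((StarSubalgebra.mem_centralizer_iff ℂ).1 (star_mem hT) x hx).1.symm⟩

theorem commute_of_mem_generatedVN {S : Set (H →L[ℂ] H)} {x T : H →L[ℂ] H}
    (hx : x ∈ generatedVN S) (hT : ∀ s ∈ S, Commute s T) (hT' : ∀ s ∈ S, Commute (star s) T) :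
    Commute x T :=
  ((StarSubalgebra.mem_centralizer_iff ℂ).1 hx T
    ((StarSubalgebra.mem_centralizer_iff ℂ).2 fun s hs => ⟨hT s hs, hT' s hs⟩)).1.symm

theorem generatedVN_le {S : Set (H →L[ℂ] H)} {P : VonNeumannAlgebra H}
    (h : S ⊆ P) : generatedVN S ≤ P := by
  intro x hx
  rw [← P.commutant_commutant, VonNeumannAlgebra.mem_commutant_iff]
  intro T hT
  rw [VonNeumannAlgebra.mem_commutant_iff] at hT
  exact (commute_of_mem_generatedVN hx (fun s hs => hT s (h hs))
    fun s hs => hT _ (star_mem (h hs))).symm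

theorem starProjection_commute {K : Submodule ℂ H} [K.HasOrthogonalProjection]
    {T : H →L[ℂ] H} (hT : ∀ ξ ∈ K, T ξ ∈ K) (hT' : ∀ ξ ∈ K, star T ξ ∈ K) :
    Commute K.starProjection T := by
  rw [ContinuousLinearMap.IsIdempotentElem.commute_iff
      isStarProjection_starProjection.isIdempotentElem,
    Submodule.range_starProjection, Submodule.ker_starProjection]
  exact ⟨hT, ContinuousLinearMap.orthogonal_mem_invtSubmodule hT'⟩

theorem apply_mem_of_mem_generatedVN {S : Set (H →L[ℂ] H)} {K : Submodule ℂ H}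
    [K.HasOrthogonalProjection] (hS : ∀ s ∈ S, ∀ ξ ∈ K, s ξ ∈ K)
    (hS' : ∀ s ∈ S, ∀ ξ ∈ K, star s ξ ∈ K) {x : H →L[ℂ] H} (hx : x ∈ generatedVN S)
    {ξ : H} (hξ : ξ ∈ K) : x ξ ∈ K := by
  have hcomm : Commute x K.starProjection := commute_of_mem_generatedVN hx
    (fun s hs => (starProjection_commute (hS s hs) (hS' s hs)).symm)
    fun s hs => (starProjection_commute (hS' s hs) (by simpa using hS s hs)).symm
  rw [← Submodule.starProjection_eq_self_iff]
  calc K.starProjection (x ξ) = x (K.starProjection ξ) := congr($hcomm ξ).symm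
    _ = x ξ := by rw [Submodule.starProjection_eq_self_iff.2 hξ]

theorem coe_eq_cornerSum {q : H →L[ℂ] H} {P M N : VonNeumannAlgebra H}
    (hq : IsIdempotentElem q)
    (hM : ∀ x ∈ P, q * x ∈ M) (hM' : ∀ x ∈ M, q * x ∈ P)
    (hN : ∀ x ∈ P, (1 - q) * x ∈ N) (hN' : ∀ x ∈ N, (1 - q) * x ∈ P) :
    (P : Set (H →L[ℂ] H)) = cornerSum q M N := by
  ext x
  constructor
  · intro hx
    refine ⟨q * x, hM x hx, (1 - q) * x, hN x hx, ?_⟩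
    rw [← mul_assoc, ← mul_assoc, hq.eq, hq.one_sub.eq, ← add_mul, add_sub_cancel, one_mul]
  · rintro ⟨y, hy, z, hz, rfl⟩
    exact add_mem (hM' y hy) (hN' z hz)

theorem cornerSum_self {q : H →L[ℂ] H} {M : VonNeumannAlgebra H} (hq : IsIdempotentElem q)
    (hqM : q ∈ M) : cornerSum q M M = M :=
  (coe_eq_cornerSum hq (fun _ hx => mul_mem hqM hx) (fun _ hx => mul_mem hqM hx)
    (fun _ hx => mul_mem (sub_mem (one_mem M) hqM) hx)
    fun _ hx => mul_mem (sub_mem (one_mem M) hqM) hx).symm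

end VonNeumannAlgebra

section EllTwo

variable {Γ : Type*}

/-- The canonical basis vector `δ_γ` of `ℓ²(Γ)`. -/
noncomputable def deltaVec (γ : Γ) : EllTwo Γ :=
  letI := Classical.decEq Γ
  lp.single 2 γ (1 : ℂ)

open Classical in
theorem deltaVec_apply (γ h : Γ) : deltaVec γ h = if h = γ then 1 else 0 := by
  rw [deltaVec, lp.single_apply, Pi.single_apply]

theorem deltaVec_of_ne {γ h : Γ} (hne : h ≠ γ) : deltaVec γ h = 0 := by
  rw [deltaVec_apply, if_neg hne]

theorem inner_deltaVec_left (γ : Γ) (ξ : EllTwo Γ) : ⟪deltaVec γ, ξ⟫_ℂ = ξ γ := by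
  classical
  rw [deltaVec, lp.inner_single_left]
  simp

theorem inner_deltaVec_right (γ : Γ) (ξ : EllTwo Γ) :
    ⟪ξ, deltaVec γ⟫_ℂ = starRingEnd ℂ (ξ γ) := by
  rw [← inner_conj_symm, inner_deltaVec_left]

theorem hasSum_deltaVec (ξ : EllTwo Γ) : HasSum (fun γ => ξ γ • deltaVec γ) ξ := by
  classical
  convert lp.hasSum_single (p := 2) (by norm_num) ξ using 2 with γ
  rw [deltaVec, ← lp.single_smul, smul_eq_mul, mul_one]

theorem continuousLinearMap_ext_deltaVec {F : Type*} [NormedAddCommGroup F] [NormedSpace ℂ F]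
    {S T : EllTwo Γ →L[ℂ] F} (h : ∀ γ, S (deltaVec γ) = T (deltaVec γ)) : S = T := by
  ext1 ξ
  refine ((hasSum_deltaVec ξ).mapL S).unique ?_
  simpa only [map_smul, h] using (hasSum_deltaVec ξ).mapL T

theorem apply_mem_of_forall_apply_deltaVec_mem {K : Submodule ℂ (EllTwo Γ)}
    (hK : IsClosed (K : Set (EllTwo Γ))) (T : EllTwo Γ →L[ℂ] EllTwo Γ) {ξ : EllTwo Γ}
    (h : ∀ γ, ξ γ ≠ 0 → T (deltaVec γ) ∈ K) : T ξ ∈ K := by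
  refine hK.mem_of_tendsto ((hasSum_deltaVec ξ).mapL T)
    (Filter.Eventually.of_forall fun _ => K.sum_mem fun γ _ => ?_)
  rw [map_smul]
  by_cases hγ : ξ γ = 0
  · simp [hγ]
  · exact K.smul_mem _ (h γ hγ)

theorem eq_zero_of_forall_apply_eq {ι : Type*} [Infinite ι] {f : ι → Γ}
    (hf : Function.Injective f) {ξ : EllTwo Γ} {c : ℂ} (h : ∀ i, ξ (f i) = c) : c = 0 := by
  have hsum : Summable fun γ => ‖ξ γ‖ ^ 2 := by
    simpa using (memℓp_gen_iff (p := 2) (by norm_num)).1 (lp.memℓp ξ)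
  have hconst := (hsum.comp_injective hf).tendsto_cofinite_zero
  simp only [Function.comp_def, h] at hconst
  simpa using tendsto_nhds_unique tendsto_const_nhds hconst

/-- The closed subspace of all `ξ ∈ ℓ²(Γ)` that vanish outside `S`, encoded as an orthogonal
complement. -/
noncomputable def supportedOn (S : Set Γ) : Submodule ℂ (EllTwo Γ) :=
  (Submodule.span ℂ (deltaVec '' Sᶜ))ᗮ

theorem mem_supportedOn {S : Set Γ} {ξ : EllTwo Γ} :
    ξ ∈ supportedOn S ↔ ∀ γ ∉ S, ξ γ = 0 := by
  rw [supportedOn, Submodule.mem_orthogonal]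
  refine ⟨fun h γ hγ => ?_, fun h η hη => ?_⟩
  · rw [← inner_deltaVec_left]
    exact h _ (Submodule.subset_span ⟨γ, hγ, rfl⟩)
  · induction hη using Submodule.span_induction with
    | mem η hη =>
      obtain ⟨γ, hγ, rfl⟩ := hη
      rw [inner_deltaVec_left, h γ hγ]
    | zero => exact inner_zero_left ξ
    | add η ζ _ _ hη hζ => rw [inner_add_left, hη, hζ, add_zero]
    | smul c η _ hη => rw [inner_smul_left, hη, mul_zero]

noncomputable instance (S : Set Γ) : (supportedOn S).HasOrthogonalProjection :=
  inferInstanceAs (Submodule.HasOrthogonalProjection (Submodule.orthogonal _))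

end EllTwo

section RegularRepresentations

variable {Γ : Type*} [Group Γ]

@[simp]
theorem leftRegularOp_apply (γ h : Γ) (ξ : EllTwo Γ) : leftRegularOp γ ξ h = ξ (γ⁻¹ * h) := rfl

theorem leftRegularOp_deltaVec (γ h : Γ) : leftRegularOp γ (deltaVec h) = deltaVec (γ * h) := by
  classical
  ext k
  simp [deltaVec_apply, inv_mul_eq_iff_eq_mul]

theorem leftRegularOp_mul (γ h : Γ) :
    leftRegularOp γ * leftRegularOp h = leftRegularOp (γ * h) := by
  ext ξ k
  simp [mul_assoc]

theorem leftRegularOp_one : leftRegularOp (1 : Γ) = 1 := by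
  ext ξ k
  simp

theorem star_leftRegularOp (γ : Γ) : star (leftRegularOp γ) = leftRegularOp γ⁻¹ := by
  classical
  rw [ContinuousLinearMap.star_eq_adjoint, eq_comm]
  refine continuousLinearMap_ext_deltaVec fun h => ?_
  ext k
  rw [← inner_deltaVec_left k, ← inner_deltaVec_left k, ContinuousLinearMap.adjoint_inner_right]
  simp only [leftRegularOp_deltaVec, inner_deltaVec_left, deltaVec_apply, eq_inv_mul_iff_mul_eq]

/-- The right regular representation: `(ρ_γ ξ)(h) = ξ(h γ)`, so that `ρ_γ δ_h = δ_{h γ⁻¹}`. -/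
noncomputable def rightRegularOp (γ : Γ) : EllTwo Γ →L[ℂ] EllTwo Γ :=
  LinearIsometry.toContinuousLinearMap
    { toFun := fun ξ => ⟨fun h => ξ (h * γ), by
        have hξ := (memℓp_gen_iff (by norm_num)).1 (lp.memℓp ξ)
        exact memℓp_gen ((Equiv.mulRight γ).summable_iff.2 hξ)⟩
      map_add' := fun _ _ => rfl
      map_smul' := fun _ _ => rfl
      norm_map' := fun ξ => by
        rw [lp.norm_eq_tsum_rpow (by norm_num), lp.norm_eq_tsum_rpow (by norm_num)]
        congr 1
        exact (Equiv.mulRight γ).tsum_eq (fun h => ‖ξ h‖ ^ (2 : ENNReal).toReal) }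

@[simp]
theorem rightRegularOp_apply (γ h : Γ) (ξ : EllTwo Γ) : rightRegularOp γ ξ h = ξ (h * γ) := rfl

theorem rightRegularOp_deltaVec (γ h : Γ) :
    rightRegularOp γ (deltaVec h) = deltaVec (h * γ⁻¹) := by
  classical
  ext k
  simp [deltaVec_apply, eq_mul_inv_iff_mul_eq]

theorem star_rightRegularOp (γ : Γ) : star (rightRegularOp γ) = rightRegularOp γ⁻¹ := by
  classical
  rw [ContinuousLinearMap.star_eq_adjoint, eq_comm]
  refine continuousLinearMap_ext_deltaVec fun h => ?_
  ext k
  rw [← inner_deltaVec_left k, ← inner_deltaVec_left k, ContinuousLinearMap.adjoint_inner_right]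
  simp only [rightRegularOp_deltaVec, inner_deltaVec_left, deltaVec_apply, inv_inv,
    mul_inv_eq_iff_eq_mul]

theorem commute_leftRegularOp_rightRegularOp (γ h : Γ) :
    Commute (leftRegularOp γ) (rightRegularOp h) := by
  ext ξ k
  simp [mul_assoc]

variable (Γ) in
/-- The conjugate-linear isometry `(J ξ)(h) = conj (ξ (h⁻¹))` of `ℓ²(Γ)`. -/
noncomputable def modularConj : EllTwo Γ →ₛₗᵢ[starRingEnd ℂ] EllTwo Γ where
  toFun := fun ξ => ⟨fun h => starRingEnd ℂ (ξ h⁻¹), by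
    have hξ := (memℓp_gen_iff (by norm_num)).1 (lp.memℓp ξ)
    refine memℓp_gen ?_
    simpa [Function.comp_def] using (Equiv.inv Γ).summable_iff.2 hξ⟩
  map_add' := fun ξ η => by ext h; exact map_add (starRingEnd ℂ) _ _
  map_smul' := fun c ξ => by ext h; exact map_mul (starRingEnd ℂ) _ _
  norm_map' := fun ξ => by
    rw [lp.norm_eq_tsum_rpow (by norm_num), lp.norm_eq_tsum_rpow (by norm_num)]
    congr 1
    simpa using (Equiv.inv Γ).tsum_eq (fun h => ‖ξ h‖ ^ (2 : ENNReal).toReal)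

@[simp]
theorem modularConj_apply (ξ : EllTwo Γ) (h : Γ) :
    modularConj Γ ξ h = starRingEnd ℂ (ξ h⁻¹) := rfl

theorem modularConj_modularConj (ξ : EllTwo Γ) : modularConj Γ (modularConj Γ ξ) = ξ := by
  ext h
  simp

theorem modularConj_deltaVec (γ : Γ) : modularConj Γ (deltaVec γ) = deltaVec γ⁻¹ := by
  ext k
  simp [deltaVec_apply, inv_eq_iff_eq_inv, apply_ite]

theorem inner_modularConj_left (ξ η : EllTwo Γ) :
    ⟪modularConj Γ ξ, η⟫_ℂ = ⟪modularConj Γ η, ξ⟫_ℂ := by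
  rw [lp.inner_eq_tsum, lp.inner_eq_tsum, ← (Equiv.inv Γ).tsum_eq]
  refine tsum_congr fun h => ?_
  simp [mul_comm]

theorem rightRegularOp_eq_modularConj (γ : Γ) (ξ : EllTwo Γ) :
    rightRegularOp γ ξ = modularConj Γ (leftRegularOp γ (modularConj Γ ξ)) := by
  ext h
  simp

end RegularRepresentations

section GroupVN

variable {Γ : Type*} [Group Γ]

variable (Γ) in
/-- The group von Neumann algebra `L(Γ)`, encoded as the commutant of the right regular
representation. -/
noncomputable def groupVN : VonNeumannAlgebra (EllTwo Γ) :=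
  (generatedVN (Set.range rightRegularOp)).commutant

theorem mem_groupVN_iff {x : EllTwo Γ →L[ℂ] EllTwo Γ} :
    x ∈ groupVN Γ ↔ ∀ γ, Commute x (rightRegularOp γ) := by
  rw [groupVN, VonNeumannAlgebra.mem_commutant_iff]
  refine ⟨fun h γ => (h _ (subset_generatedVN _ ⟨γ, rfl⟩)).symm, fun h T hT =>
    commute_of_mem_generatedVN hT ?_ ?_⟩
  · rintro _ ⟨γ, rfl⟩
    exact (h γ).symm
  · rintro _ ⟨γ, rfl⟩
    rw [star_rightRegularOp]
    exact (h γ⁻¹).symm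

theorem leftRegularOp_mem_groupVN (γ : Γ) : leftRegularOp γ ∈ groupVN Γ :=
  mem_groupVN_iff.2 (commute_leftRegularOp_rightRegularOp γ)

theorem apply_deltaVec_of_mem_groupVN {x : EllTwo Γ →L[ℂ] EllTwo Γ} (hx : x ∈ groupVN Γ) (γ : Γ) :
    x (deltaVec γ) = rightRegularOp γ⁻¹ (x (deltaVec 1)) := by
  have h : x (rightRegularOp γ⁻¹ (deltaVec 1)) = _ :=
    congr($(mem_groupVN_iff.1 hx γ⁻¹) (deltaVec 1))
  rwa [rightRegularOp_deltaVec, inv_inv, one_mul] at h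

theorem groupVN_ext {x y : EllTwo Γ →L[ℂ] EllTwo Γ} (hx : x ∈ groupVN Γ) (hy : y ∈ groupVN Γ)
    (h : x (deltaVec 1) = y (deltaVec 1)) : x = y :=
  continuousLinearMap_ext_deltaVec fun γ => by
    rw [apply_deltaVec_of_mem_groupVN hx, apply_deltaVec_of_mem_groupVN hy, h]

theorem modularConj_apply_deltaVec_one {x : EllTwo Γ →L[ℂ] EllTwo Γ} (hx : x ∈ groupVN Γ) :
    modularConj Γ (x (deltaVec 1)) = star x (deltaVec 1) := by
  ext h
  rw [← inner_deltaVec_left h (star x _), ContinuousLinearMap.star_eq_adjoint,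
    ContinuousLinearMap.adjoint_inner_right, inner_deltaVec_right,
    apply_deltaVec_of_mem_groupVN hx h]
  simp

theorem apply_deltaVec_one_eq_zero_of_notMem {G : Subgroup Γ} {x : EllTwo Γ →L[ℂ] EllTwo Γ}
    (hx : x ∈ generatedVN (leftRegularOp '' (G : Set Γ))) {γ : Γ} (hγ : γ ∉ G) :
    x (deltaVec 1) γ = 0 := by
  have invariant : ∀ g ∈ G, ∀ ξ ∈ supportedOn (G : Set Γ),
      leftRegularOp g ξ ∈ supportedOn (G : Set Γ) := fun g hg ξ hξ =>
    mem_supportedOn.2 fun h hh => mem_supportedOn.1 hξ _ <| by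
      simpa [G.mul_mem_cancel_left (G.inv_mem hg)] using hh
  refine mem_supportedOn.1 (apply_mem_of_mem_generatedVN (K := supportedOn (G : Set Γ))
    ?_ ?_ hx ?_) γ hγ
  · rintro _ ⟨g, hg, rfl⟩
    exact invariant g hg
  · rintro _ ⟨g, hg, rfl⟩
    rw [star_leftRegularOp]
    exact invariant g⁻¹ (G.inv_mem hg)
  · refine mem_supportedOn.2 fun h hh => deltaVec_of_ne ?_
    rintro rfl
    exact hh G.one_mem

end GroupVN

section CyclicSubspace

variable {Γ : Type*} [Group Γ] {P : VonNeumannAlgebra (EllTwo Γ)}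

/-- The closure of `P δ_1` in `ℓ²(Γ)`, the `L²`-space of `P` for the canonical trace of `L(Γ)`. -/
noncomputable def cyclicSubspace (P : VonNeumannAlgebra (EllTwo Γ)) : Submodule ℂ (EllTwo Γ) :=
  (P.toStarSubalgebra.toSubalgebra.toSubmodule.map
    (ContinuousLinearMap.apply ℂ (EllTwo Γ) (deltaVec (1 : Γ))).toLinearMap).topologicalClosure

noncomputable instance (P : VonNeumannAlgebra (EllTwo Γ)) : CompleteSpace (cyclicSubspace P) :=
  inferInstanceAs (CompleteSpace (Submodule.topologicalClosure _))

theorem isClosed_cyclicSubspace (P : VonNeumannAlgebra (EllTwo Γ)) :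
    IsClosed (cyclicSubspace P : Set (EllTwo Γ)) :=
  Submodule.isClosed_topologicalClosure _

theorem apply_deltaVec_one_mem_cyclicSubspace {x : EllTwo Γ →L[ℂ] EllTwo Γ} (hx : x ∈ P) :
    x (deltaVec 1) ∈ cyclicSubspace P :=
  subset_closure ⟨x, hx, rfl⟩

theorem cyclicSubspace_induction {p : EllTwo Γ → Prop} (hp : IsClosed {ξ | p ξ})
    (h : ∀ x ∈ P, p (x (deltaVec 1))) {ξ : EllTwo Γ} (hξ : ξ ∈ cyclicSubspace P) : p ξ := by
  refine closure_minimal ?_ hp hξ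
  rintro _ ⟨x, hx, rfl⟩
  exact h x hx

theorem map_mem_cyclicSubspace {Q : VonNeumannAlgebra (EllTwo Γ)} {f : EllTwo Γ → EllTwo Γ}
    (hf : Continuous f) (h : ∀ x ∈ P, f (x (deltaVec 1)) ∈ cyclicSubspace Q) {ξ : EllTwo Γ}
    (hξ : ξ ∈ cyclicSubspace P) : f ξ ∈ cyclicSubspace Q :=
  cyclicSubspace_induction (p := fun ξ => f ξ ∈ cyclicSubspace Q)
    ((isClosed_cyclicSubspace Q).preimage hf) h hξ

theorem apply_mem_cyclicSubspace {x : EllTwo Γ →L[ℂ] EllTwo Γ} (hx : x ∈ P) {ξ : EllTwo Γ}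
    (hξ : ξ ∈ cyclicSubspace P) : x ξ ∈ cyclicSubspace P :=
  map_mem_cyclicSubspace x.continuous
    (fun y hy => apply_deltaVec_one_mem_cyclicSubspace (x := x * y) (mul_mem hx hy)) hξ

theorem modularConj_mem_cyclicSubspace (hP : P ≤ groupVN Γ) {ξ : EllTwo Γ}
    (hξ : ξ ∈ cyclicSubspace P) : modularConj Γ ξ ∈ cyclicSubspace P :=
  map_mem_cyclicSubspace (modularConj Γ).continuous (fun x hx => by
    rw [modularConj_apply_deltaVec_one (hP hx)]
    exact apply_deltaVec_one_mem_cyclicSubspace (star_mem hx)) hξ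

theorem inner_commutant_apply_of_mem_cyclicSubspace (hP : P ≤ groupVN Γ)
    {T : EllTwo Γ →L[ℂ] EllTwo Γ} (hT : T ∈ P.commutant) (γ k : Γ) {ξ : EllTwo Γ}
    (hξ : ξ ∈ cyclicSubspace P) :
    ⟪deltaVec k, T (rightRegularOp γ⁻¹ ξ)⟫_ℂ =
      ⟪rightRegularOp k⁻¹ (modularConj Γ ξ), T (deltaVec γ)⟫_ℂ := by
  refine cyclicSubspace_induction (p := fun ξ => ⟪deltaVec k, T (rightRegularOp γ⁻¹ ξ)⟫_ℂ =
    ⟪rightRegularOp k⁻¹ (modularConj Γ ξ), T (deltaVec γ)⟫_ℂ) ?_ (fun x hx => ?_) hξ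
  · have hJ := (modularConj Γ).continuous
    exact isClosed_eq (by fun_prop) (by fun_prop)
  · have hTx : x (T (deltaVec γ)) = T (x (deltaVec γ)) :=
      congr($(VonNeumannAlgebra.mem_commutant_iff.1 hT x hx) (deltaVec γ))
    rw [modularConj_apply_deltaVec_one (hP hx), ← apply_deltaVec_of_mem_groupVN (hP hx),
      ← apply_deltaVec_of_mem_groupVN (star_mem (hP hx)), ContinuousLinearMap.star_eq_adjoint,
      ContinuousLinearMap.adjoint_inner_left, hTx]

theorem mem_of_apply_mem_cyclicSubspace (hP : P ≤ groupVN Γ) {x : EllTwo Γ →L[ℂ] EllTwo Γ}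
    (hx : x ∈ groupVN Γ) (h : x (deltaVec 1) ∈ cyclicSubspace P) : x ∈ P := by
  rw [← P.commutant_commutant, VonNeumannAlgebra.mem_commutant_iff]
  refine fun T hT => continuousLinearMap_ext_deltaVec fun γ => ?_
  ext k
  have key := inner_commutant_apply_of_mem_cyclicSubspace hP hT γ k h
  rwa [modularConj_apply_deltaVec_one hx, ← apply_deltaVec_of_mem_groupVN hx,
    ← apply_deltaVec_of_mem_groupVN (star_mem hx), ContinuousLinearMap.star_eq_adjoint,
    ContinuousLinearMap.adjoint_inner_left, inner_deltaVec_left, inner_deltaVec_left] at key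

/-- The orthogonal projection of `ℓ²(Γ)` onto the closure of `P δ_1`; it plays the role of the
trace-preserving conditional expectation of `L(Γ)` onto `P`. -/
noncomputable def cyclicProj (P : VonNeumannAlgebra (EllTwo Γ)) : EllTwo Γ →L[ℂ] EllTwo Γ :=
  (cyclicSubspace P).starProjection

theorem cyclicProj_apply_mem (P : VonNeumannAlgebra (EllTwo Γ)) (ξ : EllTwo Γ) :
    cyclicProj P ξ ∈ cyclicSubspace P :=
  Submodule.starProjection_apply_mem _ _

theorem cyclicProj_eq_self {ξ : EllTwo Γ} (hξ : ξ ∈ cyclicSubspace P) : cyclicProj P ξ = ξ :=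
  Submodule.starProjection_eq_self_iff.2 hξ

theorem cyclicProj_apply_of_mem {x : EllTwo Γ →L[ℂ] EllTwo Γ} (hx : x ∈ P) (ξ : EllTwo Γ) :
    cyclicProj P (x ξ) = x (cyclicProj P ξ) :=
  congr($(starProjection_commute (fun _ => apply_mem_cyclicSubspace hx)
    (fun _ => apply_mem_cyclicSubspace (star_mem hx))) ξ)

theorem cyclicProj_modularConj (hP : P ≤ groupVN Γ) (ξ : EllTwo Γ) :
    cyclicProj P (modularConj Γ ξ) = modularConj Γ (cyclicProj P ξ) := by
  refine Submodule.eq_starProjection_of_mem_of_inner_eq_zero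
    (modularConj_mem_cyclicSubspace hP (cyclicProj_apply_mem P ξ)) fun η hη => ?_
  rw [← map_sub, inner_modularConj_left, ← inner_conj_symm]
  exact (congrArg (starRingEnd ℂ) (Submodule.starProjection_inner_eq_zero _ _
    (modularConj_mem_cyclicSubspace hP hη))).trans (map_zero _)

theorem cyclicProj_rightRegularOp (hP : P ≤ groupVN Γ) {γ : Γ} (hγ : leftRegularOp γ ∈ P)
    (ξ : EllTwo Γ) : cyclicProj P (rightRegularOp γ ξ) = rightRegularOp γ (cyclicProj P ξ) := by
  rw [rightRegularOp_eq_modularConj, cyclicProj_modularConj hP, cyclicProj_apply_of_mem hγ,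
    cyclicProj_modularConj hP, ← rightRegularOp_eq_modularConj]

theorem inner_cyclicProj_left (ξ η : EllTwo Γ) :
    ⟪cyclicProj P ξ, η⟫_ℂ = ⟪ξ, cyclicProj P η⟫_ℂ :=
  Submodule.inner_starProjection_left_eq_right _ _ _

theorem cyclicProj_deltaVec_mul_left {g : Γ} (hg : leftRegularOp g ∈ P) (γ k : Γ) :
    cyclicProj P (deltaVec (g * γ)) (g * k) = cyclicProj P (deltaVec γ) k := by
  rw [← leftRegularOp_deltaVec, cyclicProj_apply_of_mem hg, leftRegularOp_apply,
    inv_mul_cancel_left]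

theorem cyclicProj_deltaVec_mul_right (hP : P ≤ groupVN Γ) {g : Γ} (hg : leftRegularOp g ∈ P)
    (γ k : Γ) : cyclicProj P (deltaVec (γ * g)) (k * g) = cyclicProj P (deltaVec γ) k := by
  rw [← mul_inv_cancel_right γ g, ← rightRegularOp_deltaVec, cyclicProj_rightRegularOp hP hg,
    mul_inv_cancel_right, rightRegularOp_apply]

theorem cyclicProj_deltaVec_of_mem {γ : Γ} (hγ : leftRegularOp γ ∈ P) :
    cyclicProj P (deltaVec γ) = deltaVec γ := by
  refine cyclicProj_eq_self ?_
  simpa [leftRegularOp_deltaVec] using apply_deltaVec_one_mem_cyclicSubspace hγ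

theorem cyclicProj_deltaVec_apply_eq_zero {γ k : Γ} (hk : leftRegularOp k ∈ P) (hne : γ ≠ k) :
    cyclicProj P (deltaVec γ) k = 0 := by
  rw [← inner_deltaVec_left, ← inner_cyclicProj_left, cyclicProj_deltaVec_of_mem hk,
    inner_deltaVec_left, deltaVec_of_ne hne.symm]

theorem cyclicProj_leftRegularOp_of_mem (hP : P ≤ groupVN Γ) (w : Γ) {x : EllTwo Γ →L[ℂ] EllTwo Γ}
    (hx : x ∈ P) : cyclicProj P (leftRegularOp w (x (deltaVec 1))) =
      modularConj Γ (star x (modularConj Γ (cyclicProj P (deltaVec w)))) := by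
  have h : leftRegularOp w (x (deltaVec 1)) =
      modularConj Γ (star x (modularConj Γ (deltaVec w))) := by
    have hstar := modularConj_apply_deltaVec_one
      (mul_mem (leftRegularOp_mem_groupVN w) (hP hx))
    rw [star_mul, star_leftRegularOp] at hstar
    simp only [mul_apply_eq_comp, leftRegularOp_deltaVec, mul_one] at hstar
    rw [modularConj_deltaVec, ← hstar, modularConj_modularConj]
  rw [h, cyclicProj_modularConj hP, cyclicProj_apply_of_mem (star_mem hx),
    cyclicProj_modularConj hP]

theorem cyclicProj_leftRegularOp_apply (hP : P ≤ groupVN Γ) (w γ : Γ) {ξ : EllTwo Γ}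
    (hξ : ξ ∈ cyclicSubspace P) :
    cyclicProj P (leftRegularOp w ξ) γ =
      ⟪modularConj Γ (cyclicProj P (deltaVec w)), rightRegularOp γ ξ⟫_ℂ := by
  refine cyclicSubspace_induction (p := fun ξ => cyclicProj P (leftRegularOp w ξ) γ =
      ⟪modularConj Γ (cyclicProj P (deltaVec w)), rightRegularOp γ ξ⟫_ℂ) ?_ (fun x hx => ?_) hξ
  · simp only [← inner_deltaVec_left]
    exact isClosed_eq (by fun_prop) (by fun_prop)
  · rw [cyclicProj_leftRegularOp_of_mem hP w hx, modularConj_apply, ← inner_deltaVec_right,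
      ContinuousLinearMap.star_eq_adjoint, ContinuousLinearMap.adjoint_inner_left,
      apply_deltaVec_of_mem_groupVN (hP hx), inv_inv]

-- The bimodule property of the conditional expectation: `e(u_w ξ)` is the convolution
-- `e(u_w) * ξ` for `ξ` in the closure of `P δ_1`.
theorem hasSum_cyclicProj_deltaVec_mul (hP : P ≤ groupVN Γ) (w γ : Γ) {ξ : EllTwo Γ}
    (hξ : ξ ∈ cyclicSubspace P) :
    HasSum (fun h => cyclicProj P (deltaVec w) h * ξ (h⁻¹ * γ))
      (cyclicProj P (leftRegularOp w ξ) γ) := by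
  rw [cyclicProj_leftRegularOp_apply hP w γ hξ]
  have h := lp.hasSum_inner (𝕜 := ℂ) (modularConj Γ (cyclicProj P (deltaVec w)))
    (rightRegularOp γ ξ)
  rw [← (Equiv.inv Γ).hasSum_iff] at h
  refine h.congr_fun fun k => ?_
  simp [mul_comm]

theorem hasSum_mul_cyclicProj_deltaVec (P : VonNeumannAlgebra (EllTwo Γ)) (w γ : Γ)
    (ξ : EllTwo Γ) :
    HasSum (fun k => ξ k * cyclicProj P (deltaVec (w * k)) γ)
      (cyclicProj P (leftRegularOp w ξ) γ) := by
  have h := (hasSum_deltaVec ξ).mapL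
    ((innerSL ℂ (deltaVec γ)).comp ((cyclicProj P).comp (leftRegularOp w)))
  simpa only [ContinuousLinearMap.comp_apply, map_smul, innerSL_apply_apply, inner_deltaVec_left,
    leftRegularOp_deltaVec, smul_eq_mul] using h

end CyclicSubspace

section Involution

variable {Γ : Type*} [Group Γ] {P : VonNeumannAlgebra (EllTwo Γ)} {z : Γ} {σ : ℂ}

/-- The operator `(1 + σ u_z) / 2`: for an involution `z` and a sign `σ`, the spectral projection
of `u_z` for the eigenvalue `σ`. -/
noncomputable def signProj (z : Γ) (σ : ℂ) : EllTwo Γ →L[ℂ] EllTwo Γ :=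
  (1 / 2 : ℂ) • (1 + σ • leftRegularOp z)

theorem signProj_apply (hzz : z * z = 1) (ξ : EllTwo Γ) (γ : Γ) :
    signProj z σ ξ γ = (ξ γ + σ * ξ (z * γ)) / 2 := by
  change (1 / 2 : ℂ) * (ξ γ + σ * ξ (z⁻¹ * γ)) = _
  rw [inv_eq_of_mul_eq_one_left hzz]
  ring

theorem signProj_mem (hz : leftRegularOp z ∈ P) (σ : ℂ) : signProj z σ ∈ P :=
  P.toStarSubalgebra.smul_mem
    (add_mem (one_mem _) (P.toStarSubalgebra.smul_mem hz _)) _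

theorem isStarProjection_signProj (hzz : z * z = 1) (hσ : σ * σ = 1) :
    IsStarProjection (signProj z σ) := by
  have hstar : starRingEnd ℂ σ = σ := by
    rcases mul_self_eq_one_iff.1 hσ with rfl | rfl <;> simp
  constructor
  · ext ξ γ
    change signProj z σ (signProj z σ ξ) γ = _
    simp only [signProj_apply hzz, ← mul_assoc z, hzz, one_mul]
    linear_combination ξ γ * hσ / 4
  · simp [IsSelfAdjoint, signProj, star_leftRegularOp, inv_eq_of_mul_eq_one_left hzz, hstar]

theorem signProj_apply_mul_left (hzz : z * z = 1) (hσ : σ * σ = 1) (ξ : EllTwo Γ) (γ : Γ) :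
    signProj z σ ξ (z * γ) = σ * signProj z σ ξ γ := by
  simp only [signProj_apply hzz, ← mul_assoc z, hzz, one_mul]
  linear_combination -ξ (z * γ) * hσ / 2

theorem signProj_leftRegularOp (hzz : z * z = 1) (hσ : σ * σ = 1) (ξ : EllTwo Γ) :
    signProj z σ (leftRegularOp z ξ) = σ • signProj z σ ξ := by
  ext γ
  change _ = σ * signProj z σ ξ γ
  simp only [signProj_apply hzz, leftRegularOp_apply, inv_eq_of_mul_eq_one_left hzz,
    ← mul_assoc z, hzz, one_mul]
  linear_combination -ξ (z * γ) * hσ / 2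

theorem signProj_leftRegularOp_of_commute {g : Γ} (hg : Commute z g) (ξ : EllTwo Γ) :
    signProj z σ (leftRegularOp g ξ) = leftRegularOp g (signProj z σ ξ) := by
  have hcomm : Commute (leftRegularOp z) (leftRegularOp g) := by
    rw [Commute, SemiconjBy, leftRegularOp_mul, leftRegularOp_mul, hg]
  have hcomm' : Commute (signProj z σ) (leftRegularOp g) :=
    ((Commute.one_left _).add_left (hcomm.smul_left σ)).smul_left _
  exact congr($hcomm' ξ)

theorem signProj_rightRegularOp (g : Γ) (ξ : EllTwo Γ) :
    signProj z σ (rightRegularOp g ξ) = rightRegularOp g (signProj z σ ξ) := by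
  have hcomm : Commute (signProj z σ) (rightRegularOp g) :=
    ((Commute.one_left _).add_left
      ((commute_leftRegularOp_rightRegularOp z g).smul_left σ)).smul_left _
  exact congr($hcomm ξ)

/-- The operator `(1 + u_z ρ_z) / 2`; for an involution `z` it projects onto the vectors that are
invariant under conjugation by `z`. -/
noncomputable def conjInvariantProj (z : Γ) : EllTwo Γ →L[ℂ] EllTwo Γ :=
  (1 / 2 : ℂ) • (1 + leftRegularOp z * rightRegularOp z)

theorem conjInvariantProj_deltaVec (γ : Γ) :
    conjInvariantProj z (deltaVec γ) =
      (1 / 2 : ℂ) • (deltaVec γ + deltaVec (z * γ * z⁻¹)) := by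
  simp [conjInvariantProj, leftRegularOp_deltaVec, rightRegularOp_deltaVec, mul_assoc]

theorem leftRegularOp_rightRegularOp_of_mem_cyclicSubspace (hP : P ≤ groupVN Γ)
    (hz : leftRegularOp z ∈ P.commutant) {ξ : EllTwo Γ} (hξ : ξ ∈ cyclicSubspace P) :
    leftRegularOp z (rightRegularOp z ξ) = ξ := by
  refine cyclicSubspace_induction (p := fun ξ => leftRegularOp z (rightRegularOp z ξ) = ξ)
    (isClosed_eq (by fun_prop) continuous_id) (fun x hx => ?_) hξ
  have hcomm : x (leftRegularOp z (rightRegularOp z (deltaVec 1))) =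
      leftRegularOp z (x (rightRegularOp z (deltaVec 1))) :=
    congr($(VonNeumannAlgebra.mem_commutant_iff.1 hz x hx) (rightRegularOp z (deltaVec 1)))
  have hright : x (rightRegularOp z (deltaVec 1)) = rightRegularOp z (x (deltaVec 1)) :=
    congr($(mem_groupVN_iff.1 (hP hx) z) (deltaVec 1))
  rw [← hright, ← hcomm, rightRegularOp_deltaVec, leftRegularOp_deltaVec, one_mul, mul_inv_cancel]

theorem conjInvariantProj_of_mem_cyclicSubspace (hP : P ≤ groupVN Γ)
    (hz : leftRegularOp z ∈ P.commutant) {ξ : EllTwo Γ} (hξ : ξ ∈ cyclicSubspace P) :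
    conjInvariantProj z ξ = ξ := by
  change (1 / 2 : ℂ) • (ξ + leftRegularOp z (rightRegularOp z ξ)) = ξ
  rw [leftRegularOp_rightRegularOp_of_mem_cyclicSubspace hP hz hξ]
  module

theorem apply_mul_eq_apply_mul_of_mem_cyclicSubspace (hP : P ≤ groupVN Γ)
    (hz : leftRegularOp z ∈ P.commutant) {ξ : EllTwo Γ} (hξ : ξ ∈ cyclicSubspace P) (γ : Γ) :
    ξ (γ * z) = ξ (z * γ) := by
  have h := congr(($(leftRegularOp_rightRegularOp_of_mem_cyclicSubspace hP hz hξ) : EllTwo Γ)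
    (z * γ))
  rwa [leftRegularOp_apply, rightRegularOp_apply, inv_mul_cancel_left] at h

theorem cyclicProj_conjInvariantProj (hP : P ≤ groupVN Γ) (hz : leftRegularOp z ∈ P)
    (hz' : leftRegularOp z ∈ P.commutant) (ξ : EllTwo Γ) :
    cyclicProj P (conjInvariantProj z ξ) = cyclicProj P ξ := by
  rw [← conjInvariantProj_of_mem_cyclicSubspace hP hz' (cyclicProj_apply_mem P ξ)]
  simp [conjInvariantProj, cyclicProj_apply_of_mem hz, cyclicProj_rightRegularOp hP hz]

/-- The image `q e(δ_γ)` of `δ_γ` in the corner cut out by `q = signProj z σ`, where `e` is the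
projection onto the closure of `P δ_1`. -/
noncomputable def cornerVec (P : VonNeumannAlgebra (EllTwo Γ)) (z : Γ) (σ : ℂ) (γ : Γ) :
    EllTwo Γ :=
  signProj z σ (cyclicProj P (deltaVec γ))

theorem cornerVec_mem_cyclicSubspace (hz : leftRegularOp z ∈ P) (γ : Γ) :
    cornerVec P z σ γ ∈ cyclicSubspace P :=
  apply_mem_cyclicSubspace (signProj_mem hz σ) (cyclicProj_apply_mem P _)

theorem cornerVec_apply_mul_left (hzz : z * z = 1) (hσ : σ * σ = 1) (γ k : Γ) :
    cornerVec P z σ γ (z * k) = σ * cornerVec P z σ γ k :=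
  signProj_apply_mul_left hzz hσ _ k

theorem cornerVec_apply_mul_right (hP : P ≤ groupVN Γ) (hzz : z * z = 1)
    (hz : leftRegularOp z ∈ P) (hz' : leftRegularOp z ∈ P.commutant) (hσ : σ * σ = 1) (γ k : Γ) :
    cornerVec P z σ γ (k * z) = σ * cornerVec P z σ γ k := by
  rw [apply_mul_eq_apply_mul_of_mem_cyclicSubspace hP hz' (cornerVec_mem_cyclicSubspace hz γ),
    cornerVec_apply_mul_left hzz hσ]

theorem cornerVec_mul_left {g : Γ} (hg : leftRegularOp g ∈ P)
    (hz' : leftRegularOp z ∈ P.commutant) (γ : Γ) :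
    cornerVec P z σ (g * γ) = leftRegularOp g (cornerVec P z σ γ) := by
  have hcomm : leftRegularOp g * signProj z σ = signProj z σ * leftRegularOp g :=
    VonNeumannAlgebra.mem_commutant_iff.1 (signProj_mem hz' σ) _ hg
  rw [cornerVec, ← leftRegularOp_deltaVec, cyclicProj_apply_of_mem hg]
  exact congr($hcomm.symm _)

theorem cornerVec_mul_right (hP : P ≤ groupVN Γ) {g : Γ} (hg : leftRegularOp g ∈ P) (γ : Γ) :
    cornerVec P z σ (γ * g) = rightRegularOp g⁻¹ (cornerVec P z σ γ) := by
  have hg' : leftRegularOp g⁻¹ ∈ P := star_leftRegularOp g ▸ star_mem hg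
  rw [cornerVec, cornerVec, ← signProj_rightRegularOp, ← cyclicProj_rightRegularOp hP hg',
    rightRegularOp_deltaVec, inv_inv]

theorem cyclicProj_leftRegularOp_apply_eq_left (hP : P ≤ groupVN Γ) (hzz : z * z = 1) (hz1 : z ≠ 1)
    (hz' : leftRegularOp z ∈ P.commutant) {η : EllTwo Γ} (hη : η ∈ cyclicSubspace P)
    (hησ : ∀ γ, η (z * γ) = σ * η γ) {w γ h₀ : Γ}
    (hsupp : ∀ h, cyclicProj P (deltaVec w) h * η (h⁻¹ * γ) ≠ 0 → h = h₀ ∨ h = h₀ * z) :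
    cyclicProj P (leftRegularOp w η) γ = 2 * (cornerVec P z σ w h₀ * η (h₀⁻¹ * γ)) := by
  rw [(hasSum_cyclicProj_deltaVec_mul hP w γ hη).unique
    (hasSum_pair (by simpa using hz1) hsupp), cornerVec, signProj_apply hzz, mul_inv_rev,
    inv_eq_of_mul_eq_one_left hzz, mul_assoc z, hησ,
    apply_mul_eq_apply_mul_of_mem_cyclicSubspace hP hz' (cyclicProj_apply_mem P _)]
  ring

theorem cyclicProj_leftRegularOp_apply_eq_right (hP : P ≤ groupVN Γ) (hzz : z * z = 1)
    (hz1 : z ≠ 1) (hz : leftRegularOp z ∈ P) (hz' : leftRegularOp z ∈ P.commutant)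
    {η : EllTwo Γ} (hησ : ∀ γ, η (γ * z) = σ * η γ) {w γ k₀ : Γ}
    (hsupp : ∀ k, η k * cyclicProj P (deltaVec (w * k)) γ ≠ 0 → k = k₀ ∨ k = k₀ * z) :
    cyclicProj P (leftRegularOp w η) γ = 2 * (η k₀ * cornerVec P z σ (w * k₀) γ) := by
  have hE : cyclicProj P (deltaVec (w * k₀ * z)) γ = cyclicProj P (deltaVec (w * k₀)) (z * γ) := by
    rw [← apply_mul_eq_apply_mul_of_mem_cyclicSubspace hP hz' (cyclicProj_apply_mem P _),
      ← cyclicProj_deltaVec_mul_right hP hz (w * k₀) (γ * z), mul_assoc γ, hzz, mul_one]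
  rw [(hasSum_mul_cyclicProj_deltaVec P w γ η).unique
    (hasSum_pair (by simpa using hz1) hsupp), cornerVec, signProj_apply hzz, hησ, ← mul_assoc w, hE]
  ring

theorem signProj_conjInvariantProj_deltaVec_mul_left (hzz : z * z = 1) (hσ : σ * σ = 1) (γ : Γ) :
    signProj z σ (conjInvariantProj z (deltaVec (z * γ))) =
      σ • signProj z σ (conjInvariantProj z (deltaVec γ)) := by
  have hleft : conjInvariantProj z (deltaVec (z * γ)) =
      leftRegularOp z (conjInvariantProj z (deltaVec γ)) := by
    simp only [conjInvariantProj_deltaVec, map_smul, map_add, leftRegularOp_deltaVec, mul_assoc]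
  rw [hleft, signProj_leftRegularOp hzz hσ]

theorem signProj_conjInvariantProj_deltaVec_mul_right (hzz : z * z = 1) (hσ : σ * σ = 1) (γ : Γ) :
    signProj z σ (conjInvariantProj z (deltaVec (γ * z))) =
      σ • signProj z σ (conjInvariantProj z (deltaVec γ)) := by
  rw [← signProj_conjInvariantProj_deltaVec_mul_left hzz hσ, conjInvariantProj_deltaVec,
    conjInvariantProj_deltaVec, inv_eq_of_mul_eq_one_left hzz, add_comm]
  simp only [mul_assoc, hzz, mul_one, ← mul_assoc z z, one_mul]

theorem signProj_conjInvariantProj_deltaVec_mul_mul {g h : Γ} (hg : Commute z g)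
    (hh : Commute z h) (γ : Γ) :
    signProj z σ (conjInvariantProj z (deltaVec (g * γ * h))) =
      leftRegularOp g (rightRegularOp h⁻¹ (signProj z σ (conjInvariantProj z (deltaVec γ)))) := by
  have hconj : z * (g * γ * h) * z⁻¹ = g * (z * γ * z⁻¹) * h := by
    rw [← mul_assoc, ← mul_assoc, hg, mul_assoc _ h, ← hh.inv_left]
    simp only [mul_assoc]
  rw [← signProj_rightRegularOp, ← signProj_leftRegularOp_of_commute hg]
  rw [conjInvariantProj_deltaVec, conjInvariantProj_deltaVec, hconj]
  simp only [map_smul, map_add, rightRegularOp_deltaVec, leftRegularOp_deltaVec, inv_inv,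
    mul_assoc]

-- With `q = signProj z σ`, `e = cyclicProj P` and `t = conjInvariantProj z`: once `ξ = q e δ_γ` is
-- a multiple `c q t δ_γ`, applying `e` gives `ξ = c q e t δ_γ = c ξ`.
theorem cornerVec_eq_zero_or_eq (hP : P ≤ groupVN Γ) (hzz : z * z = 1) (hσ : σ * σ = 1)
    (hz : leftRegularOp z ∈ P) (hz' : leftRegularOp z ∈ P.commutant) {γ : Γ}
    (hsupp : ∀ k, cornerVec P z σ γ k ≠ 0 → k = γ ∨ k = z * γ ∨ k = γ * z ∨ k = z * γ * z) :
    cornerVec P z σ γ = 0 ∨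
      cornerVec P z σ γ = signProj z σ (conjInvariantProj z (deltaVec γ)) := by
  set ξ := cornerVec P z σ γ with hξ
  have hξP : ξ ∈ cyclicSubspace P := cornerVec_mem_cyclicSubspace hz γ
  set v := signProj z σ (conjInvariantProj z (deltaVec γ)) with hv
  obtain ⟨c, hc⟩ : ∃ c : ℂ, c • v = ξ := by
    rw [← Submodule.mem_span_singleton]
    have hqt : signProj z σ (conjInvariantProj z ξ) = ξ := by
      rw [conjInvariantProj_of_mem_cyclicSubspace hP hz' hξP]
      exact congr($((isStarProjection_signProj hzz hσ).isIdempotentElem) _)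
    rw [← hqt]
    refine apply_mem_of_forall_apply_deltaVec_mem (Submodule.closed_of_finiteDimensional _)
      (signProj z σ * conjInvariantProj z) fun k hk => ?_
    have hmem := Submodule.mem_span_singleton_self (R := ℂ) v
    change signProj z σ (conjInvariantProj z (deltaVec k)) ∈ _
    rcases hsupp k hk with rfl | rfl | rfl | rfl <;>
      simp only [signProj_conjInvariantProj_deltaVec_mul_left hzz hσ,
        signProj_conjInvariantProj_deltaVec_mul_right hzz hσ, ← hv, Submodule.smul_mem, hmem]
  have hcξ : ξ = c • ξ := by
    conv_lhs => rw [← cyclicProj_eq_self hξP, ← hc, map_smul, hv,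
      cyclicProj_apply_of_mem (signProj_mem hz σ), cyclicProj_conjInvariantProj hP hz hz',
      ← cornerVec, ← hξ]
  rcases eq_or_ne c 1 with rfl | hc1
  · exact Or.inr (by rw [← hc, one_smul])
  · refine Or.inl ((smul_eq_zero.1 (?_ : (c - 1) • ξ = 0)).resolve_left (sub_ne_zero.2 hc1))
    rw [sub_smul, one_smul, ← hcξ, sub_self]

end Involution

section AffineGroup

open Matrix.SpecialLinearGroup

/-- The element `(v, g)` of `ℚ² ⋊ SL₂(ℚ)`. -/
def aff (v : Fin 2 → ℚ) (g : SL2Q) : AffineSL2Q := ⟨Multiplicative.ofAdd v, g⟩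

theorem exists_eq_aff (γ : AffineSL2Q) : ∃ v g, γ = aff v g :=
  ⟨γ.left.toAdd, γ.right, rfl⟩

theorem aff_inj {v w : Fin 2 → ℚ} {g h : SL2Q} : aff v g = aff w h ↔ v = w ∧ g = h :=
  SemidirectProduct.ext_iff

theorem aff_mul (v w : Fin 2 → ℚ) (g h : SL2Q) :
    aff v g * aff w h = aff (v + g • w) (g * h) := rfl

theorem aff_inv (v : Fin 2 → ℚ) (g : SL2Q) : (aff v g)⁻¹ = aff (-(g⁻¹ • v)) g⁻¹ := by
  rw [inv_eq_iff_mul_eq_one, aff_mul, smul_neg, smul_inv_smul, add_neg_cancel, mul_inv_cancel]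
  rfl

theorem aff_conj (v : Fin 2 → ℚ) (g h : SL2Q) :
    aff 0 g * aff v h * (aff 0 g)⁻¹ = aff (g • v) (g * h * g⁻¹) := by
  simp [aff_inv, aff_mul]

theorem aff_zero_mul_aff_mul_aff_zero (v : Fin 2 → ℚ) (g h k : SL2Q) :
    aff 0 g * aff v h * aff 0 k = aff (g • v) (g * h * k) := by
  simp [aff_mul]

theorem sl2Q_smul (g : SL2Q) (v : Fin 2 → ℚ) :
    g • v = ![g 0 0 * v 0 + g 0 1 * v 1, g 1 0 * v 0 + g 1 1 * v 1] :=
  Matrix.mulVec_fin_two g.1 v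

/-- The element `-id` of `SL₂(ℚ) ⊆ ℚ² ⋊ SL₂(ℚ)`, whose spectral projections are `q` and
`1 - q`. -/
def negId : AffineSL2Q := aff 0 (-1)

theorem negId_mul_aff (v : Fin 2 → ℚ) (g : SL2Q) : negId * aff v g = aff (-v) (-g) := by
  rw [negId, aff_mul, zero_add, neg_one_mul]
  congr 1
  ext i
  fin_cases i <;> simp [sl2Q_smul]

theorem aff_mul_negId (v : Fin 2 → ℚ) (g : SL2Q) : aff v g * negId = aff v (-g) := by
  rw [negId, aff_mul, smul_zero, add_zero, mul_neg_one]

theorem negId_mul_self : negId * negId = 1 :=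
  (negId_mul_aff 0 (-1)).trans (by rw [neg_zero, neg_neg]; rfl)

theorem negId_ne_one : negId ≠ 1 := fun h => by
  have h00 := congr(($(congr_arg SemidirectProduct.right h) : SL2Q) 0 0)
  norm_num [negId, aff] at h00

theorem commute_negId (g : SL2Q) : Commute negId (aff 0 g) := by
  rw [Commute, SemiconjBy, negId_mul_aff, aff_mul_negId, neg_zero]

theorem exists_sl2Q_smul_eq {v : Fin 2 → ℚ} (hv : v ≠ 0) : ∃ g : SL2Q, g • ![1, 0] = v := by
  have hcop : IsCoprime (v 0) (v 1) := by
    by_cases h0 : v 0 = 0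
    · have h1 : v 1 ≠ 0 := fun h1 => hv (by ext i; fin_cases i <;> assumption)
      exact ⟨0, (v 1)⁻¹, by simp [h1]⟩
    · exact ⟨(v 0)⁻¹, 0, by simp [h0]⟩
  obtain ⟨g, h0, h1⟩ := hcop.exists_SL2_col 0
  refine ⟨g, ?_⟩
  ext i
  fin_cases i <;> simp [sl2Q_smul, h0, h1]

theorem sl2Q_det (g : SL2Q) : g 0 0 * g 1 1 - g 0 1 * g 1 0 = 1 := by
  rw [← Matrix.det_fin_two]
  exact g.det_coe

theorem sl2Q_mul_apply (g h : SL2Q) (i j : Fin 2) :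
    (g * h) i j = g i 0 * h 0 j + g i 1 * h 1 j := by
  simp [Matrix.mul_apply, Fin.sum_univ_two]

theorem neg_sl2Q_smul (g : SL2Q) (v : Fin 2 → ℚ) : (-g) • v = -(g • v) := by
  ext i
  fin_cases i <;> simp [sl2Q_smul] <;> ring

/-- The subgroup of all `(w, g)` in `ℚ² ⋊ SL₂(ℚ)` with `w ∈ ℚ v` and `g v = ± v`. It contains
every element whose conjugacy class under the stabilizer of `v` in `SL₂(ℚ)` is finite. -/
def lineStabilizer (v : Fin 2 → ℚ) : Subgroup AffineSL2Q where
  carrier := {γ | (∃ t : ℚ, γ.left.toAdd = t • v) ∧ (γ.right • v = v ∨ γ.right • v = -v)}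
  one_mem' := ⟨⟨0, (zero_smul ℚ v).symm⟩, Or.inl (one_smul _ _)⟩
  mul_mem' := by
    rintro ⟨w, g⟩ ⟨w', g'⟩ ⟨⟨t, ht : w.toAdd = t • v⟩, hg : g • v = v ∨ g • v = -v⟩
      ⟨⟨t', ht' : w'.toAdd = t' • v⟩, hg' : g' • v = v ∨ g' • v = -v⟩
    change (∃ r : ℚ, w.toAdd + g • w'.toAdd = r • v) ∧ ((g * g') • v = v ∨ (g * g') • v = -v)
    rw [mul_smul, ht, ht', smul_comm g t' v]
    constructor
    · rcases hg with hg | hg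
      · exact ⟨t + t', by rw [hg, add_smul]⟩
      · exact ⟨t - t', by rw [hg, smul_neg, sub_smul, sub_eq_add_neg]⟩
    · rcases hg with hg | hg <;> rcases hg' with hg' | hg' <;> simp [hg, hg']
  inv_mem' := by
    rintro ⟨w, g⟩ ⟨⟨t, ht : w.toAdd = t • v⟩, hg : g • v = v ∨ g • v = -v⟩
    change (∃ r : ℚ, g⁻¹ • -w.toAdd = r • v) ∧ (g⁻¹ • v = v ∨ g⁻¹ • v = -v)
    have hg' : g⁻¹ • v = v ∨ g⁻¹ • v = -v :=
      hg.imp (fun h => inv_smul_eq_iff.2 h.symm)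
        (fun h => inv_smul_eq_iff.2 (by rw [smul_neg, h, neg_neg]))
    refine ⟨?_, hg'⟩
    rw [ht, ← neg_smul, smul_comm g⁻¹ (-t) v]
    rcases hg' with h | h
    · exact ⟨-t, by rw [h]⟩
    · exact ⟨t, by rw [h, smul_neg, neg_smul, neg_neg]⟩

theorem aff_mem_lineStabilizer {v w : Fin 2 → ℚ} {g : SL2Q} :
    aff w g ∈ lineStabilizer v ↔ (∃ t : ℚ, w = t • v) ∧ (g • v = v ∨ g • v = -v) := Iff.rfl

theorem negId_mem_lineStabilizer (v : Fin 2 → ℚ) : negId ∈ lineStabilizer v :=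
  aff_mem_lineStabilizer.2 ⟨⟨0, (zero_smul ℚ v).symm⟩, Or.inr (by rw [neg_sl2Q_smul, one_smul])⟩

theorem conj_mem_lineStabilizer {v : Fin 2 → ℚ} {g : SL2Q} {γ : AffineSL2Q}
    (hγ : γ ∈ lineStabilizer v) :
    aff 0 g * γ * (aff 0 g)⁻¹ ∈ lineStabilizer (g • v) := by
  obtain ⟨w, h, rfl⟩ := exists_eq_aff γ
  obtain ⟨⟨t, rfl⟩, hh⟩ := aff_mem_lineStabilizer.1 hγ
  rw [aff_conj, aff_mem_lineStabilizer, mul_smul, inv_smul_smul, mul_smul, smul_comm g t v,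
    ← smul_neg]
  exact ⟨⟨t, rfl⟩, hh.imp (congr_arg _) (congr_arg _)⟩

/-- The matrix `[[1, s], [0, 1]]`. -/
def upperShear (s : ℚ) : SL2Q := transvection zero_ne_one s

/-- The matrix `[[1, 0], [s, 1]]`. -/
def lowerShear (s : ℚ) : SL2Q := transvection one_ne_zero s

theorem coe_upperShear (s : ℚ) : (upperShear s : Matrix (Fin 2) (Fin 2) ℚ) = !![1, s; 0, 1] := by
  ext i j
  fin_cases i <;> fin_cases j <;> simp [upperShear, transvection_coe]

theorem coe_lowerShear (s : ℚ) : (lowerShear s : Matrix (Fin 2) (Fin 2) ℚ) = !![1, 0; s, 1] := by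
  ext i j
  fin_cases i <;> fin_cases j <;> simp [lowerShear, transvection_coe]

theorem upperShear_zero : upperShear 0 = 1 := transvection_coeff_zero _

theorem lowerShear_zero : lowerShear 0 = 1 := transvection_coeff_zero _

theorem upperShear_mul (s t : ℚ) : upperShear s * upperShear t = upperShear (s + t) :=
  Subtype.ext (by simp [coe_upperShear, add_comm])

theorem upperShear_smul (s : ℚ) : upperShear s • (![1, 0] : Fin 2 → ℚ) = ![1, 0] := by
  simp [sl2Q_smul, coe_upperShear]

theorem eq_upperShear_of_smul_eq {g : SL2Q} (h : g • (![1, 0] : Fin 2 → ℚ) = ![1, 0]) :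
    g = upperShear (g 0 1) := by
  have h00 := congr_fun h 0
  have h10 := congr_fun h 1
  have hdet := sl2Q_det g
  simp only [sl2Q_smul, Matrix.cons_val_zero, Matrix.cons_val_one, mul_one, mul_zero,
    add_zero] at h00 h10
  rw [h00, h10, mul_zero, sub_zero, one_mul] at hdet
  refine Subtype.ext ((Matrix.eta_fin_two g.1).trans ?_)
  rw [coe_upperShear, h00, h10, hdet]

/-- The element `(t e₁, [[1, s], [0, 1]])` of `ℚ² ⋊ SL₂(ℚ)`. -/
def affShear (t s : ℚ) : AffineSL2Q := aff ![t, 0] (upperShear s)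

theorem affShear_mem_lineStabilizer (t s : ℚ) : affShear t s ∈ lineStabilizer ![1, 0] :=
  aff_mem_lineStabilizer.2 ⟨⟨t, by simp⟩, Or.inl (upperShear_smul s)⟩

theorem exists_eq_affShear {γ : AffineSL2Q} (hγ : γ ∈ lineStabilizer ![1, 0]) :
    ∃ t s, γ = affShear t s ∨ γ = affShear t s * negId := by
  obtain ⟨w, g, rfl⟩ := exists_eq_aff γ
  obtain ⟨⟨t, rfl⟩, hg | hg⟩ := aff_mem_lineStabilizer.1 hγ
  · exact ⟨t, g 0 1, Or.inl (aff_inj.2 ⟨by simp, eq_upperShear_of_smul_eq hg⟩)⟩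
  · have hg' : (-g) • (![1, 0] : Fin 2 → ℚ) = ![1, 0] := by rw [neg_sl2Q_smul, hg, neg_neg]
    refine ⟨t, (-g) 0 1, Or.inr ?_⟩
    rw [affShear, aff_mul_negId, ← eq_upperShear_of_smul_eq hg', neg_neg, aff_inj]
    exact ⟨by simp, rfl⟩

theorem eq_one_or_eq_negId_of_mem_lineStabilizer {γ : AffineSL2Q}
    (h₁ : γ ∈ lineStabilizer ![1, 0]) (h₂ : γ ∈ lineStabilizer ![0, 1]) : γ = 1 ∨ γ = negId := by
  have hone : ∀ {t s : ℚ}, affShear t s ∈ lineStabilizer ![0, 1] → affShear t s = 1 := by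
    intro t s hts
    obtain ⟨⟨r, hr⟩, hs⟩ := aff_mem_lineStabilizer.1 hts
    have ht : t = 0 := by simpa using congr_fun hr 0
    have hs' : s = 0 := by
      rcases hs with hs | hs <;> simpa [sl2Q_smul, coe_upperShear] using congr_fun hs 0
    rw [affShear, ht, hs', upperShear_zero]
    exact aff_inj.2 ⟨by simp, rfl⟩
  obtain ⟨t, s, rfl | rfl⟩ := exists_eq_affShear h₁
  · exact Or.inl (hone h₂)
  · right
    rw [hone ((Subgroup.mul_mem_cancel_right _ (negId_mem_lineStabilizer _)).1 h₂), one_mul]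

theorem mem_lineStabilizer_of_commute {r : ℚ} (hr : r ≠ 0) {γ : AffineSL2Q}
    (hγ : Commute (aff 0 (upperShear r)) γ) : γ ∈ lineStabilizer ![1, 0] := by
  obtain ⟨w, h, rfl⟩ := exists_eq_aff γ
  rw [Commute, SemiconjBy, aff_mul, aff_mul, aff_inj, zero_add, smul_zero, add_zero] at hγ
  obtain ⟨hw, hh⟩ := hγ
  have hw1 : w 1 = 0 := by simpa [sl2Q_smul, coe_upperShear, hr] using congr_fun hw 0
  have h10 : h 1 0 = 0 := by
    simpa [sl2Q_mul_apply, coe_upperShear, hr] using congr($hh 0 0)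
  have h11 : h 1 1 = h 0 0 := by
    have h01 : h 0 1 + r * h 1 1 = h 0 0 * r + h 0 1 := by
      simpa [sl2Q_mul_apply, coe_upperShear] using congr($hh 0 1)
    exact mul_left_cancel₀ hr (by linear_combination h01)
  have hdet := sl2Q_det h
  rw [h10, h11, mul_zero, sub_zero, mul_self_eq_one_iff] at hdet
  rw [aff_mem_lineStabilizer]
  refine ⟨⟨w 0, ?_⟩, hdet.imp (fun h00 => ?_) (fun h00 => ?_)⟩ <;> ext i <;> fin_cases i <;>
    simp [sl2Q_smul, *]

theorem exists_conj_affShear_eq :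
    ∃ g : SL2Q, g • (![1, 0] : Fin 2 → ℚ) = ![0, 1] ∧
      ∀ t s, aff 0 g * affShear t s * (aff 0 g)⁻¹ = aff ![0, t] (lowerShear (-s)) := by
  let g : SL2Q := ⟨!![0, -1; 1, 0], by simp⟩
  have hg : (g : Matrix (Fin 2) (Fin 2) ℚ) = !![0, -1; 1, 0] := rfl
  refine ⟨g, by simp [sl2Q_smul, hg], fun t s => ?_⟩
  rw [affShear, aff_conj, aff_inj, mul_inv_eq_iff_eq_mul]
  refine ⟨by simp [sl2Q_smul, hg], Subtype.ext ?_⟩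
  simp [coe_upperShear, coe_lowerShear, hg]

theorem affShear_zero (t : ℚ) : affShear t 0 = aff ![t, 0] 1 := by
  rw [affShear, upperShear_zero]

theorem affShear_eq_mul (t s p : ℚ) : affShear t s = affShear t (s - p) * aff 0 (upperShear p) := by
  rw [affShear, affShear, aff_mul, smul_zero, add_zero, upperShear_mul, sub_add_cancel]

theorem lowerShear_mem_lineStabilizer (b y : ℚ) :
    aff ![0, b] (lowerShear y) ∈ lineStabilizer ![0, 1] :=
  aff_mem_lineStabilizer.2 ⟨⟨b, by simp⟩, Or.inl (by simp [sl2Q_smul, coe_lowerShear])⟩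

theorem eq_of_lowerShear_mul_affShear_mem_lineStabilizer {a b r t y : ℚ}
    (h : aff ![0, b] (lowerShear y) * affShear a r ∈ lineStabilizer ![t, 1]) :
    a = t * (b + y * a) ∧ (r = 0 ∧ y * t = 0 ∨ y * t = 2) := by
  rw [affShear, aff_mul, aff_mem_lineStabilizer, mul_smul] at h
  obtain ⟨⟨c, hc⟩, hrt⟩ := h
  have hc0 : a = c * t := by simpa [sl2Q_smul, coe_lowerShear] using congr_fun hc 0
  have hc1 : b + y * a = c := by simpa [sl2Q_smul, coe_lowerShear] using congr_fun hc 1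
  refine ⟨by rw [hc1, hc0, mul_comm], hrt.imp (fun hrt => ?_) (fun hrt => ?_)⟩ <;>
  · have h0 := congr_fun hrt 0
    have h1 := congr_fun hrt 1
    simp only [sl2Q_smul, coe_lowerShear, coe_upperShear, Matrix.of_apply, Matrix.cons_val',
      Matrix.cons_val_zero, Matrix.cons_val_one, Matrix.cons_val_fin_one, Pi.neg_apply] at h0 h1
    grind

end AffineGroup

section CrossedProduct

theorem leftRegularOp_aff_zero_mem_LSL2Q (g : SL2Q) : leftRegularOp (aff 0 g) ∈ LSL2Q :=
  subset_generatedVN _ ⟨g, rfl⟩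

theorem LSL2Q_le_crossedProduct : LSL2Q ≤ crossedProduct :=
  generatedVN_le (Set.subset_union_right.trans (subset_generatedVN _))

theorem LQ2_le_groupVN : LQ2 ≤ groupVN AffineSL2Q :=
  generatedVN_le (Set.range_subset_iff.2 fun v => leftRegularOp_mem_groupVN (translation v))

theorem crossedProduct_le_groupVN : crossedProduct ≤ groupVN AffineSL2Q :=
  generatedVN_le (Set.union_subset (fun _ ha => LQ2_le_groupVN ha.1)
    (Set.range_subset_iff.2 fun g => leftRegularOp_mem_groupVN (SemidirectProduct.inr g)))

theorem apply_deltaVec_one_eq_zero_of_mem_LQ2 {a : EllTwo AffineSL2Q →L[ℂ] EllTwo AffineSL2Q}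
    (ha : a ∈ LQ2) (v : Fin 2 → ℚ) {g : SL2Q} (hg : g ≠ 1) : a (deltaVec 1) (aff v g) = 0 := by
  have hrange : Set.range uVec =
      leftRegularOp '' ((SemidirectProduct.inl (φ := sl2QAction)).range : Set AffineSL2Q) := by
    rw [MonoidHom.coe_range, ← Set.range_comp]
    rfl
  rw [LQ2, hrange] at ha
  refine apply_deltaVec_one_eq_zero_of_notMem ha ?_
  rintro ⟨w, hw⟩
  exact hg (congr_arg SemidirectProduct.right hw).symm

theorem commute_leftRegularOp_negId_of_mem_symmetricPart
    {a : EllTwo AffineSL2Q →L[ℂ] EllTwo AffineSL2Q} (ha : a ∈ symmetricPart) :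
    Commute a (leftRegularOp negId) := by
  have haΓ := LQ2_le_groupVN ha.1
  have hzΓ := leftRegularOp_mem_groupVN negId
  refine groupVN_ext (mul_mem haΓ hzΓ) (mul_mem hzΓ haΓ) ?_
  ext γ
  obtain ⟨v, g, rfl⟩ := exists_eq_aff γ
  change a (leftRegularOp negId (deltaVec 1)) (aff v g) =
    leftRegularOp negId (a (deltaVec 1)) (aff v g)
  have hinv : negId⁻¹ = negId := inv_eq_of_mul_eq_one_left negId_mul_self
  rw [leftRegularOp_deltaVec, mul_one, apply_deltaVec_of_mem_groupVN haΓ, rightRegularOp_apply,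
    leftRegularOp_apply, hinv, aff_mul_negId, negId_mul_aff]
  by_cases hg : -g = 1
  · rw [hg]
    exact ha.2 v
  · rw [apply_deltaVec_one_eq_zero_of_mem_LQ2 ha.1 _ hg,
      apply_deltaVec_one_eq_zero_of_mem_LQ2 ha.1 _ hg]

theorem leftRegularOp_negId_mem_commutant : leftRegularOp negId ∈ crossedProduct.commutant := by
  have hstar : star (leftRegularOp negId) = leftRegularOp negId := by
    rw [star_leftRegularOp, inv_eq_of_mul_eq_one_left negId_mul_self]
  have hcomm : ∀ s ∈ symmetricPart ∪ Set.range uMat, Commute s (leftRegularOp negId) := by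
    rintro s (hs | ⟨g, rfl⟩)
    · exact commute_leftRegularOp_negId_of_mem_symmetricPart hs
    · change leftRegularOp (aff 0 g) * _ = _ * leftRegularOp (aff 0 g)
      rw [leftRegularOp_mul, leftRegularOp_mul, commute_negId]
  refine VonNeumannAlgebra.mem_commutant_iff.2 fun x hx => ?_
  refine commute_of_mem_generatedVN hx hcomm fun s hs => ?_
  exact hstar ▸ (hcomm s hs).star_star

end CrossedProduct

section IntermediateAlgebra

variable {P : VonNeumannAlgebra (EllTwo AffineSL2Q)} {σ : ℂ}

theorem leftRegularOp_aff_zero_mem (hP : LSL2Q ≤ P) (g : SL2Q) : leftRegularOp (aff 0 g) ∈ P :=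
  hP (leftRegularOp_aff_zero_mem_LSL2Q g)

theorem leftRegularOp_negId_mem_commutant_of_le (hP' : P ≤ crossedProduct) :
    leftRegularOp negId ∈ P.commutant :=
  VonNeumannAlgebra.mem_commutant_iff.2 fun x hx =>
    VonNeumannAlgebra.mem_commutant_iff.1 leftRegularOp_negId_mem_commutant x (hP' hx)

theorem cyclicProj_deltaVec_conj (hP : LSL2Q ≤ P) (hPΓ : P ≤ groupVN AffineSL2Q) (g : SL2Q)
    (γ k : AffineSL2Q) :
    cyclicProj P (deltaVec (aff 0 g * γ * (aff 0 g)⁻¹)) (aff 0 g * k * (aff 0 g)⁻¹) =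
      cyclicProj P (deltaVec γ) k := by
  have hg := leftRegularOp_aff_zero_mem hP g
  rw [← cyclicProj_deltaVec_mul_right hPΓ hg, inv_mul_cancel_right, inv_mul_cancel_right,
    cyclicProj_deltaVec_mul_left hg]

theorem cornerVec_conj (hP : LSL2Q ≤ P) (hPΓ : P ≤ groupVN AffineSL2Q) (g : SL2Q)
    (γ k : AffineSL2Q) :
    cornerVec P negId σ (aff 0 g * γ * (aff 0 g)⁻¹) (aff 0 g * k * (aff 0 g)⁻¹) =
      cornerVec P negId σ γ k := by
  have hz : negId * (aff 0 g * k * (aff 0 g)⁻¹) = aff 0 g * (negId * k) * (aff 0 g)⁻¹ := by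
    simp only [← mul_assoc, (commute_negId g).eq]
  rw [cornerVec, cornerVec, signProj_apply negId_mul_self, signProj_apply negId_mul_self, hz,
    cyclicProj_deltaVec_conj hP hPΓ, cyclicProj_deltaVec_conj hP hPΓ]

theorem mem_lineStabilizer_of_cyclicProj_ne_zero_basis (hP : LSL2Q ≤ P)
    (hPΓ : P ≤ groupVN AffineSL2Q) {γ : AffineSL2Q}
    (hne : cyclicProj P (deltaVec (aff ![1, 0] 1)) γ ≠ 0) : γ ∈ lineStabilizer ![1, 0] := by
  set u : ℚ → AffineSL2Q := fun s => aff 0 (upperShear s) with hu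
  have hconst : ∀ s, cyclicProj P (deltaVec (aff ![1, 0] 1)) (u s * γ * (u s)⁻¹) =
      cyclicProj P (deltaVec (aff ![1, 0] 1)) γ := fun s => by
    have h := cyclicProj_deltaVec_conj hP hPΓ (upperShear s) (aff ![1, 0] 1) γ
    rwa [aff_conj, upperShear_smul, mul_one, mul_inv_cancel] at h
  by_contra hγ
  refine hne (eq_zero_of_forall_apply_eq (fun s p hsp => ?_) hconst)
  by_contra hne'
  have hdiff : u (s - p) = (u p)⁻¹ * u s := by
    rw [eq_inv_mul_iff_mul_eq, hu, aff_mul, smul_zero, add_zero, upperShear_mul, add_sub_cancel]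
  refine hγ (mem_lineStabilizer_of_commute (sub_ne_zero.2 hne') ?_)
  change u (s - p) * γ = γ * u (s - p)
  calc u (s - p) * γ = (u p)⁻¹ * (u s * γ * (u s)⁻¹) * u s := by rw [hdiff]; group
    _ = (u p)⁻¹ * (u p * γ * (u p)⁻¹) * u s := by rw [hsp]
    _ = γ * u (s - p) := by rw [hdiff]; group

theorem mem_lineStabilizer_of_cyclicProj_ne_zero (hP : LSL2Q ≤ P)
    (hPΓ : P ≤ groupVN AffineSL2Q) {v : Fin 2 → ℚ} (hv : v ≠ 0) {γ : AffineSL2Q}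
    (hne : cyclicProj P (deltaVec (aff v 1)) γ ≠ 0) : γ ∈ lineStabilizer v := by
  obtain ⟨g, rfl⟩ := exists_sl2Q_smul_eq hv
  obtain ⟨k, rfl⟩ : ∃ k, γ = aff 0 g * k * (aff 0 g)⁻¹ :=
    ⟨(aff 0 g)⁻¹ * γ * aff 0 g, by group⟩
  have htrans : aff (g • ![1, 0]) 1 = aff 0 g * aff ![1, 0] 1 * (aff 0 g)⁻¹ := by
    rw [aff_conj, mul_one, mul_inv_cancel]
  rw [htrans, cyclicProj_deltaVec_conj hP hPΓ] at hne
  exact conj_mem_lineStabilizer (mem_lineStabilizer_of_cyclicProj_ne_zero_basis hP hPΓ hne)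

theorem mul_inv_mem_lineStabilizer_of_cyclicProj_ne_zero (hP : LSL2Q ≤ P)
    (hPΓ : P ≤ groupVN AffineSL2Q) {v : Fin 2 → ℚ} (hv : v ≠ 0) {g : SL2Q} {γ : AffineSL2Q}
    (hne : cyclicProj P (deltaVec (aff v g)) γ ≠ 0) : γ * (aff 0 g)⁻¹ ∈ lineStabilizer v := by
  have hvg : aff v g = aff v 1 * aff 0 g := by rw [aff_mul, smul_zero, add_zero, one_mul]
  refine mem_lineStabilizer_of_cyclicProj_ne_zero hP hPΓ hv ?_
  rwa [← cyclicProj_deltaVec_mul_right hPΓ (leftRegularOp_aff_zero_mem hP g), ← hvg,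
    inv_mul_cancel_right]

theorem mem_lineStabilizer_of_cornerVec_ne_zero (hP : LSL2Q ≤ P)
    (hPΓ : P ≤ groupVN AffineSL2Q) {v : Fin 2 → ℚ} (hv : v ≠ 0) {γ : AffineSL2Q}
    (hne : cornerVec P negId σ (aff v 1) γ ≠ 0) : γ ∈ lineStabilizer v := by
  by_contra hγ
  have hγ' : negId * γ ∉ lineStabilizer v := by
    rwa [Subgroup.mul_mem_cancel_left _ (negId_mem_lineStabilizer v)]
  refine hne ?_
  rw [cornerVec, signProj_apply negId_mul_self,
    not_imp_comm.1 (mem_lineStabilizer_of_cyclicProj_ne_zero hP hPΓ hv) hγ,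
    not_imp_comm.1 (mem_lineStabilizer_of_cyclicProj_ne_zero hP hPΓ hv) hγ', mul_zero, add_zero,
    zero_div]

theorem cornerVec_aff_zero_eq_zero (hP : LSL2Q ≤ P) {v : Fin 2 → ℚ} (hv : v ≠ 0) (g : SL2Q) :
    cornerVec P negId σ (aff v 1) (aff 0 g) = 0 := by
  have hE : ∀ h, cyclicProj P (deltaVec (aff v 1)) (aff 0 h) = 0 := fun h =>
    cyclicProj_deltaVec_apply_eq_zero (leftRegularOp_aff_zero_mem hP h)
      fun heq => hv (aff_inj.1 heq).1
  rw [cornerVec, signProj_apply negId_mul_self, negId_mul_aff, neg_zero, hE, hE, mul_zero,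
    add_zero, zero_div]

/-- The coefficients of `q e(δ_{e₁})` at the elements `affShear t s`, which by
`exists_eq_affShear` determine it. -/
noncomputable def shearCoeff (P : VonNeumannAlgebra (EllTwo AffineSL2Q)) (σ : ℂ) (t s : ℚ) : ℂ :=
  cornerVec P negId σ (aff ![1, 0] 1) (affShear t s)

theorem shearCoeff_neg_left (hP : LSL2Q ≤ P) (hP' : P ≤ crossedProduct) (t s : ℚ) :
    shearCoeff P σ (-t) s = shearCoeff P σ t s := by
  have hz : leftRegularOp negId ∈ P := leftRegularOp_aff_zero_mem hP (-1)
  have hneg : affShear (-t) s * negId = negId * affShear t s := by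
    rw [affShear, affShear, aff_mul_negId, negId_mul_aff, aff_inj]
    exact ⟨by simp, rfl⟩
  have h := apply_mul_eq_apply_mul_of_mem_cyclicSubspace (hP'.trans crossedProduct_le_groupVN)
    (leftRegularOp_negId_mem_commutant_of_le hP')
    (cornerVec_mem_cyclicSubspace (σ := σ) hz (aff ![1, 0] 1))
    (affShear (-t) s * negId)
  rwa [mul_assoc, negId_mul_self, mul_one, hneg, ← mul_assoc, negId_mul_self, one_mul] at h

theorem cornerVec_lowerShear (hP : LSL2Q ≤ P) (hPΓ : P ≤ groupVN AffineSL2Q) (b y : ℚ) :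
    cornerVec P negId σ (aff ![0, 1] 1) (aff ![0, b] (lowerShear y)) = shearCoeff P σ b (-y) := by
  obtain ⟨g, hg, hconj⟩ := exists_conj_affShear_eq
  have h := cornerVec_conj (σ := σ) hP hPΓ g (aff ![1, 0] 1) (affShear b (-y))
  rwa [hconj, neg_neg, aff_conj, hg, mul_one, mul_inv_cancel] at h

theorem cornerVec_smul (hP : LSL2Q ≤ P) (hPΓ : P ≤ groupVN AffineSL2Q) {v : Fin 2 → ℚ}
    (hv : v ≠ 0) (b : ℚ) :
    cornerVec P negId σ (aff v 1) (aff (b • v) 1) = shearCoeff P σ b 0 := by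
  obtain ⟨g, rfl⟩ := exists_sl2Q_smul_eq hv
  have h := cornerVec_conj (σ := σ) hP hPΓ g (aff ![1, 0] 1) (affShear b 0)
  have hb : g • (![b, 0] : Fin 2 → ℚ) = b • g • ![1, 0] := by
    rw [← smul_comm]
    simp
  rw [shearCoeff, affShear_zero]
  rwa [affShear_zero, aff_conj, aff_conj, mul_one, mul_inv_cancel, hb] at h

theorem cyclicProj_leftRegularOp_cornerVec_apply (hP : LSL2Q ≤ P) (hP' : P ≤ crossedProduct)
    (hσ : σ * σ = 1) (a b s y : ℚ) :
    cyclicProj P (leftRegularOp (aff ![0, 1] 1) (cornerVec P negId σ (aff ![1, 0] 1)))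
        (aff ![0, b] (lowerShear y) * affShear a s) =
      2 * (shearCoeff P σ b (-y) * shearCoeff P σ a s) := by
  have hPΓ := hP'.trans crossedProduct_le_groupVN
  have hz : leftRegularOp negId ∈ P := leftRegularOp_aff_zero_mem hP (-1)
  have he₁ : (![1, 0] : Fin 2 → ℚ) ≠ 0 := by simp
  have he₂ : (![0, 1] : Fin 2 → ℚ) ≠ 0 := by simp
  rw [cyclicProj_leftRegularOp_apply_eq_left (σ := σ) (h₀ := aff ![0, b] (lowerShear y)) hPΓ
    negId_mul_self negId_ne_one (leftRegularOp_negId_mem_commutant_of_le hP')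
    (cornerVec_mem_cyclicSubspace hz _) (cornerVec_apply_mul_left negId_mul_self hσ _),
    cornerVec_lowerShear hP hPΓ, inv_mul_cancel_left, shearCoeff]
  · rfl
  intro h hh
  have h₂ := mem_lineStabilizer_of_cyclicProj_ne_zero hP hPΓ he₂ (left_ne_zero_of_mul hh)
  have h₁ := mem_lineStabilizer_of_cornerVec_ne_zero hP hPΓ he₁ (right_ne_zero_of_mul hh)
  have key : (aff ![0, b] (lowerShear y))⁻¹ * h = 1 ∨
      (aff ![0, b] (lowerShear y))⁻¹ * h = negId := by
    refine eq_one_or_eq_negId_of_mem_lineStabilizer ?_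
      (mul_mem (inv_mem (lowerShear_mem_lineStabilizer b y)) h₂)
    rwa [← mul_assoc, Subgroup.mul_mem_cancel_right _ (affShear_mem_lineStabilizer a s),
      ← inv_mem_iff, mul_inv_rev, inv_inv] at h₁
  simpa only [inv_mul_eq_iff_eq_mul, mul_one] using key

theorem eq_of_cornerVec_mul_cyclicProj_ne_zero (hP : LSL2Q ≤ P) (hPΓ : P ≤ groupVN AffineSL2Q)
    {a b s y : ℚ} {k : AffineSL2Q}
    (hne : cornerVec P negId σ (aff ![1, 0] 1) k * cyclicProj P (deltaVec (aff ![0, 1] 1 * k))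
      (aff ![0, b] (lowerShear y) * affShear a s) ≠ 0) :
    ∃ t p, (k = affShear t p ∨ k = affShear t p * negId) ∧ a = t * (b + y * a) ∧
      (p = s ∧ y * t = 0 ∨ y * t = 2) := by
  have he₁ : (![1, 0] : Fin 2 → ℚ) ≠ 0 := by simp
  obtain ⟨t, p, hk⟩ := exists_eq_affShear
    (mem_lineStabilizer_of_cornerVec_ne_zero hP hPΓ he₁ (left_ne_zero_of_mul hne))
  have hE := right_ne_zero_of_mul hne
  have ht : (![t, 1] : Fin 2 → ℚ) ≠ 0 := by simp
  have hmem : aff ![0, b] (lowerShear y) * affShear a (s - p) ∈ lineStabilizer ![t, 1] := by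
    have hmul : ∀ g, aff ![0, 1] 1 * aff ![t, 0] g = aff ![t, 1] g := fun g => by
      rw [aff_mul]; simp
    rw [affShear_eq_mul a s p, ← mul_assoc] at hE
    rcases hk with rfl | rfl
    · rw [affShear, hmul] at hE
      simpa only [mul_inv_cancel_right] using
        mul_inv_mem_lineStabilizer_of_cyclicProj_ne_zero hP hPΓ ht hE
    · rw [affShear, aff_mul_negId, hmul] at hE
      have h := mul_inv_mem_lineStabilizer_of_cyclicProj_ne_zero hP hPΓ ht hE
      have hneg : aff 0 (-upperShear p) = negId * aff 0 (upperShear p) := by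
        rw [negId_mul_aff, neg_zero]
      rwa [hneg, mul_inv_rev, ← mul_assoc, mul_inv_cancel_right, Subgroup.mul_mem_cancel_right _
        (inv_mem (negId_mem_lineStabilizer _))] at h
  obtain ⟨ha, hpt⟩ := eq_of_lowerShear_mul_affShear_mem_lineStabilizer hmem
  exact ⟨t, p, hk, ha, hpt.imp_left (And.imp_left fun h => (sub_eq_zero.1 h).symm)⟩

theorem shearCoeff_mul_eq_zero (hP : LSL2Q ≤ P) (hP' : P ≤ crossedProduct) (hσ : σ * σ = 1)
    {a b s y : ℚ} (ha : a ≠ 0) (hy : y ≠ 0) (hne : y * a + 2 * b ≠ 0) :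
    shearCoeff P σ b (-y) * shearCoeff P σ a s = 0 := by
  have hPΓ := hP'.trans crossedProduct_le_groupVN
  have hzero : ∀ k, cornerVec P negId σ (aff ![1, 0] 1) k *
      cyclicProj P (deltaVec (aff ![0, 1] 1 * k))
        (aff ![0, b] (lowerShear y) * affShear a s) = 0 := fun k => by
    by_contra hk
    obtain ⟨t, p, -, hat, ht⟩ := eq_of_cornerVec_mul_cyclicProj_ne_zero hP hPΓ hk
    have hyt : y * t = 2 := ht.resolve_left fun h => by
      rw [(mul_eq_zero.1 h.2).resolve_left hy, zero_mul] at hat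
      exact ha hat
    exact hne (by linear_combination -y * hat - (b + y * a) * hyt)
  have h := cyclicProj_leftRegularOp_cornerVec_apply hP hP' hσ a b s y
  rw [((hasSum_mul_cyclicProj_deltaVec P _ _ _).congr_fun
    fun k => (hzero k).symm).unique hasSum_zero] at h
  simpa using h.symm

theorem shearCoeff_eq_zero (hP : LSL2Q ≤ P) (hP' : P ≤ crossedProduct) (hσ : σ * σ = 1)
    {s : ℚ} (hs : s ≠ 0) (t : ℚ) : shearCoeff P σ t s = 0 := by
  rcases eq_or_ne t 0 with rfl | ht
  · have h0 : affShear 0 s = aff 0 (upperShear s) := aff_inj.2 ⟨by simp, rfl⟩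
    rw [shearCoeff, h0]
    exact cornerVec_aff_zero_eq_zero hP (by simp) _
  have hsq : shearCoeff P σ t s * shearCoeff P σ t s = 0 := by
    by_cases h2 : s = 2
    · have h := shearCoeff_mul_eq_zero hP hP' hσ (a := -t) (b := t) (s := s) (y := -s)
        (neg_ne_zero.2 ht) (neg_ne_zero.2 hs) (by rw [h2]; intro h; exact ht (by linarith))
      rwa [neg_neg, shearCoeff_neg_left hP hP'] at h
    · have h := shearCoeff_mul_eq_zero hP hP' hσ (a := t) (b := t) (s := s) (y := -s) ht
        (neg_ne_zero.2 hs) fun h => h2 (mul_right_cancel₀ ht (by linear_combination -h))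
      rwa [neg_neg] at h
  exact mul_self_eq_zero.1 hsq

theorem shearCoeff_zero_mul (hP : LSL2Q ≤ P) (hP' : P ≤ crossedProduct) (hσ : σ * σ = 1)
    {a b : ℚ} (hb : b ≠ 0) :
    shearCoeff P σ b 0 * shearCoeff P σ a 0 = shearCoeff P σ (a / b) 0 * shearCoeff P σ b 0 := by
  have hPΓ := hP'.trans crossedProduct_le_groupVN
  have hz : leftRegularOp negId ∈ P := leftRegularOp_aff_zero_mem hP (-1)
  have hz' := leftRegularOp_negId_mem_commutant_of_le hP'
  have hleft := cyclicProj_leftRegularOp_cornerVec_apply hP hP' hσ a b 0 0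
  rw [cyclicProj_leftRegularOp_apply_eq_right (σ := σ) (k₀ := affShear (a / b) 0) hPΓ
    negId_mul_self negId_ne_one hz hz' (cornerVec_apply_mul_right hPΓ negId_mul_self hz hz' hσ _)]
    at hleft
  · have hw : aff ![0, 1] 1 * affShear (a / b) 0 = aff ![a / b, 1] 1 := by
      rw [affShear_zero, aff_mul]
      simp
    have hγ : aff ![0, b] (lowerShear 0) * affShear a 0 = aff (b • ![a / b, 1]) 1 := by
      rw [affShear_zero, lowerShear_zero, aff_mul]
      simp [mul_div_cancel₀ _ hb]
    rw [hw, hγ, cornerVec_smul hP hPΓ (by simp), neg_zero] at hleft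
    exact (mul_left_cancel₀ two_ne_zero hleft).symm
  · intro k hk
    obtain ⟨t, p, hkt, hat, ⟨rfl, -⟩ | h2⟩ := eq_of_cornerVec_mul_cyclicProj_ne_zero hP hPΓ hk
    · rw [zero_mul, add_zero] at hat
      rwa [hat, mul_div_cancel_right₀ _ hb]
    · norm_num at h2

theorem shearCoeff_zero_eq_zero (hP : LSL2Q ≤ P) (hP' : P ≤ crossedProduct) (hσ : σ * σ = 1)
    {t : ℚ} (ht : |t| ≠ 1) : shearCoeff P σ t 0 = 0 := by
  rcases eq_or_ne t 0 with rfl | ht0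
  · have h0 : affShear 0 0 = aff 0 1 := (affShear_zero 0).trans (aff_inj.2 ⟨by simp, rfl⟩)
    rw [shearCoeff, h0]
    exact cornerVec_aff_zero_eq_zero hP (by simp) _
  by_contra hne
  have hpow : ∀ n : ℕ, shearCoeff P σ (t ^ (n + 1)) 0 = shearCoeff P σ t 0 := by
    intro n
    induction n with
    | zero => rw [zero_add, pow_one]
    | succ n ih =>
      rw [← ih]
      refine mul_left_cancel₀ hne ?_
      rw [shearCoeff_zero_mul hP hP' hσ ht0, mul_comm, pow_succ t (n + 1),
        mul_div_cancel_right₀ _ ht0]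
  refine hne (eq_zero_of_forall_apply_eq (f := fun n : ℕ => affShear (t ^ (n + 1)) 0)
    (fun m n hmn => ?_) hpow)
  have hmn' : t ^ (m + 1) = t ^ (n + 1) := congr_fun (aff_inj.1 hmn).1 0
  have habs : |t| ^ (m + 1) = |t| ^ (n + 1) := by rw [← abs_pow, ← abs_pow, hmn']
  exact Nat.succ_injective (pow_right_injective₀ (abs_pos.2 ht0) ht habs)

theorem cornerVec_basis_eq_zero_or_eq (hP : LSL2Q ≤ P) (hP' : P ≤ crossedProduct)
    (hσ : σ * σ = 1) :
    cornerVec P negId σ (aff ![1, 0] 1) = 0 ∨ cornerVec P negId σ (aff ![1, 0] 1) =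
      signProj negId σ (conjInvariantProj negId (deltaVec (aff ![1, 0] 1))) := by
  have hPΓ := hP'.trans crossedProduct_le_groupVN
  have hz : leftRegularOp negId ∈ P := leftRegularOp_aff_zero_mem hP (-1)
  have hz' := leftRegularOp_negId_mem_commutant_of_le hP'
  refine cornerVec_eq_zero_or_eq hPΓ negId_mul_self hσ hz hz' fun k hk => ?_
  have hshear : ∀ {t s}, shearCoeff P σ t s ≠ 0 →
      affShear t s = aff ![1, 0] 1 ∨ affShear t s = negId * aff ![1, 0] 1 * negId := by
    intro t s hts
    obtain rfl : s = 0 := not_imp_comm.1 (fun hs => shearCoeff_eq_zero hP hP' hσ hs t) hts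
    have ht : |t| = 1 := not_imp_comm.1 (shearCoeff_zero_eq_zero hP hP' hσ) hts
    rw [affShear_zero]
    refine (eq_or_eq_neg_of_abs_eq ht).imp (fun h => by rw [h]) fun h => ?_
    rw [h, negId_mul_aff, aff_mul_negId, neg_neg, aff_inj]
    exact ⟨by simp, rfl⟩
  obtain ⟨t, s, rfl | rfl⟩ := exists_eq_affShear
    (mem_lineStabilizer_of_cornerVec_ne_zero hP hPΓ (by simp) hk)
  · rcases hshear hk with h | h <;> simp [h]
  · rw [cornerVec_apply_mul_right hPΓ negId_mul_self hz hz' hσ] at hk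
    rcases hshear (right_ne_zero_of_mul hk) with h | h <;>
      simp [h, mul_assoc _ negId negId, negId_mul_self]

theorem cornerVec_aff_zero (hP : LSL2Q ≤ P) (g : SL2Q) :
    cornerVec P negId σ (aff 0 g) = signProj negId σ (deltaVec (aff 0 g)) := by
  rw [cornerVec, cyclicProj_deltaVec_of_mem (leftRegularOp_aff_zero_mem hP g)]

theorem cornerVec_eq_zero_or_forall_eq (hP : LSL2Q ≤ P) (hP' : P ≤ crossedProduct)
    (hσ : σ * σ = 1) :
    (∀ v ≠ 0, ∀ g, cornerVec P negId σ (aff v g) = 0) ∨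
      ∀ γ, cornerVec P negId σ γ = signProj negId σ (conjInvariantProj negId (deltaVec γ)) := by
  have hPΓ := hP'.trans crossedProduct_le_groupVN
  have hz' := leftRegularOp_negId_mem_commutant_of_le hP'
  have horbit : ∀ v ≠ 0, ∀ g, ∃ h k : SL2Q, aff v g = aff 0 h * aff ![1, 0] 1 * aff 0 k := by
    intro v hv g
    obtain ⟨h, rfl⟩ := exists_sl2Q_smul_eq hv
    exact ⟨h, h⁻¹ * g, by rw [aff_zero_mul_aff_mul_aff_zero, mul_one, mul_inv_cancel_left]⟩
  have htransport : ∀ h k, cornerVec P negId σ (aff 0 h * aff ![1, 0] 1 * aff 0 k) =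
      leftRegularOp (aff 0 h) (rightRegularOp (aff 0 k)⁻¹
        (cornerVec P negId σ (aff ![1, 0] 1))) := fun h k => by
    rw [mul_assoc, cornerVec_mul_left (leftRegularOp_aff_zero_mem hP h) hz',
      cornerVec_mul_right hPΓ (leftRegularOp_aff_zero_mem hP k)]
  refine (cornerVec_basis_eq_zero_or_eq hP hP' hσ).imp (fun h0 v hv g => ?_) (fun h1 γ => ?_)
  · obtain ⟨h, k, hvg⟩ := horbit v hv g
    rw [hvg, htransport, h0, map_zero, map_zero]
  · obtain ⟨v, g, rfl⟩ := exists_eq_aff γ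
    rcases eq_or_ne v 0 with rfl | hv
    · have hmem : deltaVec (aff 0 g) ∈ cyclicSubspace P := by
        rw [← cyclicProj_deltaVec_of_mem (leftRegularOp_aff_zero_mem hP g)]
        exact cyclicProj_apply_mem P _
      rw [cornerVec_aff_zero hP, conjInvariantProj_of_mem_cyclicSubspace hPΓ hz' hmem]
    · obtain ⟨h, k, hvg⟩ := horbit v hv g
      rw [hvg, htransport, h1, signProj_conjInvariantProj_deltaVec_mul_mul (commute_negId h)
        (commute_negId k)]

theorem signProj_mul_mem_LSL2Q (hP : LSL2Q ≤ P) (hPΓ : P ≤ groupVN AffineSL2Q)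
    (h0 : ∀ v ≠ 0, ∀ g, cornerVec P negId σ (aff v g) = 0)
    {x : EllTwo AffineSL2Q →L[ℂ] EllTwo AffineSL2Q} (hx : x ∈ P) :
    signProj negId σ * x ∈ LSL2Q := by
  have hq : signProj negId σ ∈ LSL2Q := signProj_mem (leftRegularOp_aff_zero_mem_LSL2Q (-1)) σ
  refine mem_of_apply_mem_cyclicSubspace (hP.trans hPΓ) (hPΓ (mul_mem (hP hq) hx)) ?_
  change signProj negId σ (x (deltaVec 1)) ∈ _
  rw [← cyclicProj_eq_self (apply_deltaVec_one_mem_cyclicSubspace hx)]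
  refine apply_mem_of_forall_apply_deltaVec_mem (isClosed_cyclicSubspace LSL2Q)
    (signProj negId σ * cyclicProj P) fun γ _ => ?_
  change cornerVec P negId σ γ ∈ _
  obtain ⟨v, g, rfl⟩ := exists_eq_aff γ
  rcases eq_or_ne v 0 with rfl | hv
  · rw [cornerVec_aff_zero hP, ← cornerVec_aff_zero le_rfl]
    exact cornerVec_mem_cyclicSubspace (leftRegularOp_aff_zero_mem_LSL2Q (-1)) _
  · rw [h0 v hv g]
    exact zero_mem _

theorem signProj_mul_mem_of_mem_crossedProduct (hP : LSL2Q ≤ P) (hPΓ : P ≤ groupVN AffineSL2Q)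
    (h1 : ∀ γ, cornerVec P negId σ γ =
      signProj negId σ (conjInvariantProj negId (deltaVec γ)))
    {x : EllTwo AffineSL2Q →L[ℂ] EllTwo AffineSL2Q} (hx : x ∈ crossedProduct) :
    signProj negId σ * x ∈ P := by
  have hz : leftRegularOp negId ∈ P := leftRegularOp_aff_zero_mem hP (-1)
  refine mem_of_apply_mem_cyclicSubspace hPΓ
    (mul_mem (hPΓ (signProj_mem hz σ)) (crossedProduct_le_groupVN hx)) ?_
  change signProj negId σ (x (deltaVec 1)) ∈ _
  rw [← conjInvariantProj_of_mem_cyclicSubspace crossedProduct_le_groupVN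
    leftRegularOp_negId_mem_commutant (apply_deltaVec_one_mem_cyclicSubspace hx)]
  refine apply_mem_of_forall_apply_deltaVec_mem (isClosed_cyclicSubspace P)
    (signProj negId σ * conjInvariantProj negId) fun γ _ => ?_
  change signProj negId σ (conjInvariantProj negId (deltaVec γ)) ∈ _
  rw [← h1]
  exact cornerVec_mem_cyclicSubspace hz γ

theorem exists_corner_eq (hP : LSL2Q ≤ P) (hP' : P ≤ crossedProduct) (hσ : σ * σ = 1) :
    ∃ M : VonNeumannAlgebra (EllTwo AffineSL2Q), (M = LSL2Q ∨ M = crossedProduct) ∧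
      (∀ x ∈ P, signProj negId σ * x ∈ M) ∧ ∀ x ∈ M, signProj negId σ * x ∈ P := by
  have hPΓ := hP'.trans crossedProduct_le_groupVN
  have hq : signProj negId σ ∈ P := signProj_mem (leftRegularOp_aff_zero_mem hP (-1)) σ
  rcases cornerVec_eq_zero_or_forall_eq hP hP' hσ with h0 | h1
  · exact ⟨LSL2Q, Or.inl rfl, fun x hx => signProj_mul_mem_LSL2Q hP hPΓ h0 hx,
      fun x hx => mul_mem hq (hP hx)⟩
  · exact ⟨crossedProduct, Or.inr rfl, fun x hx => mul_mem (hP' hq) (hP' hx),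
      fun x hx => signProj_mul_mem_of_mem_crossedProduct hP hPΓ h1 hx⟩

theorem qProj_eq_signProj : qProj = signProj negId 1 := by
  rw [qProj, signProj, one_smul, ← leftRegularOp_one]
  rfl

theorem one_sub_qProj_eq_signProj : 1 - qProj = signProj negId (-1) := by
  rw [qProj_eq_signProj, signProj, signProj]
  module

end IntermediateAlgebra

theorem mainTheorem4 :
    (IsStarProjection qProj ∧ qProj ∈ crossedProduct ∧
      ∀ x ∈ crossedProduct, qProj * x = x * qProj) ∧
    ∀ P : VonNeumannAlgebra (EllTwo AffineSL2Q), LSL2Q ≤ P → P ≤ crossedProduct →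
      (P = LSL2Q ∨ P = crossedProduct ∨
        (P : Set (EllTwo AffineSL2Q →L[ℂ] EllTwo AffineSL2Q)) =
          cornerSum qProj LSL2Q crossedProduct ∨
        (P : Set (EllTwo AffineSL2Q →L[ℂ] EllTwo AffineSL2Q)) =
          cornerSum qProj crossedProduct LSL2Q) := by
  have hq : IsStarProjection qProj := by
    rw [qProj_eq_signProj]
    exact isStarProjection_signProj negId_mul_self (one_mul 1)
  have hqL : qProj ∈ LSL2Q := by
    rw [qProj_eq_signProj]
    exact signProj_mem (leftRegularOp_aff_zero_mem_LSL2Q (-1)) 1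
  have hqC : qProj ∈ crossedProduct.commutant := by
    rw [qProj_eq_signProj]
    exact signProj_mem leftRegularOp_negId_mem_commutant 1
  refine ⟨⟨hq, LSL2Q_le_crossedProduct hqL, fun x hx =>
    (VonNeumannAlgebra.mem_commutant_iff.1 hqC x hx).symm⟩, fun P hP hP' => ?_⟩
  obtain ⟨M, hM, hPM, hMP⟩ := exists_corner_eq hP hP' (one_mul 1)
  obtain ⟨N, hN, hPN, hNP⟩ := exists_corner_eq hP hP' (σ := -1) (by norm_num)
  rw [← qProj_eq_signProj] at hPM hMP
  rw [← one_sub_qProj_eq_signProj] at hPN hNP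
  have hsum := coe_eq_cornerSum hq.isIdempotentElem hPM hMP hPN hNP
  rcases hM with rfl | rfl <;> rcases hN with rfl | rfl
  · exact Or.inl (SetLike.coe_injective (hsum.trans (cornerSum_self hq.isIdempotentElem hqL)))
  · exact Or.inr (Or.inr (Or.inl hsum))
  · exact Or.inr (Or.inr (Or.inr hsum))
  · exact Or.inr (Or.inl (SetLike.coe_injective (hsum.trans
      (cornerSum_self hq.isIdempotentElem (LSL2Q_le_crossedProduct hqL)))))
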